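/- Let $m_0:[0,1]\to\mathbb R$ be non-decreasing (hence bounded). Let $X_1,X_2,\dots$ be i.i.d. random variables with distribution function $F_0$ and $0\le X_i\le 1$ almost surely, and let $Y_1,Y_2,\dots$ be i.i.d., independent of $(X_i)_{i\ge1}$, with the distribution of $m_0(X)+\epsilon$, where $X\sim F_0$ and $\epsilon$ is independent of $X$, $E|\epsilon|<\infty$, $E(\epsilon)=0$, and $\epsilon$ has distribution function $\Phi_\epsilon$. Assume: (A3) $F_0$ is continuous. (A4) $\Phi_\epsilon$ is absolutely continuous with an even density $f_\epsilon$ which, with $\phi_{f_\epsilon}(t)=\int_{\mathbb R}e^{itx}f_\epsilon(x)\,dx$, is ordinary smooth: for some $\beta>0$ and constants $d_0,d_1>0$, $d_0|t|^{-\beta}\le|\phi_{f_\epsilon}(t)|\le d_1|t|^{-\beta}$ for all sufficiently large $|t|$. Let $\mathcal M$ be the set of bounded, non-decreasing, right-continuous functions on $[0,1]$. For every $n\ge1$ let $\widehat m_n\in\mathcal M$ be (almost surely) any minimizer over $m\in\mathcal M$ of $$\mathbb M_n(m)=\int_{\mathbb R}\Big\{\frac1n\sum_{i=1}^n\mathbf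 1_{\{Y_i\le y\}}-\frac1n\sum_{i=1}^n\Phi_\epsilon\big(y-m(X_i)\big)\Big\}^2\,dy .$$ For $w\in\mathbb R$ put $$\widehat{\mathbb L}_n(w)=\frac1n\sum_{i=1}^n\mathbf 1_{\{\widehat m_n(X_i)\le w\}},\qquad \mathbb L_n(w)=\frac1n\sum_{i=1}^n\mathbf 1_{\{m_0(X_i)\le w\}},$$ $$\widehat L^0_n(w)=\int\mathbf 1_{\{\widehat m_n(x)\le w\}}\,dF_0(x),\qquad L_0(w)=\int\mathbf 1_{\{m_0(x)\le w\}}\,dF_0(x).$$ Then there are random variables $Z_n=O_p(1/n)$ and $Z_n'=O_p(1/n)$ such that for every $n\ge1$ and all random variables $A<B$ (which may depend on $n$), almost surely, $$\int_A^B\big(\widehat{\mathbb L}_n(w)-\widehat L_n^0(w)\big)^2dw\le(B-A)\,Z_n,\qquad \int_A^B\big(\mathbb L_n(w)-L_0(w)\big)^2dw\le(B-A)\,Z_n' ;$$ here $Z_n,Z_n'$ do not depend on $A$ and $B$. Moreover, assume in addition (A5): there exists $T^*$ such that $|\phi_{f_\epsilon}(t)|\ge|\phi_{f_\epsilon}(T)|>0$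 for all $T>T^*$ and $|t|\le T$. Then for all random variables $A_n<B_n$ with $B_n-A_n=O_p(n^{2\beta/(2\beta+1)})$, $$\int_{A_n}^{B_n}\big(\widehat L^0_n(w)-L_0(w)\big)^2dw=O_p\big(n^{-1/(2\beta+1)}\big).$$ -/

import Mathlib

open MeasureTheory ProbabilityTheory Set

noncomputable section

namespace UnlinkedRegression

/-- `Z n = O_p(r n)` as `n → ∞`: for every `ε > 0` there is a constant `C > 0` such that
`P(|Z n| > C * r n) ≤ ε` for all sufficiently large `n`. For events that need not be measurable,
`P` is the outer probability. -/
def IsBigOInProb {Ω : Type*} [MeasurableSpace Ω] (P : Measure Ω)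
    (Z : ℕ → Ω → ℝ) (r : ℕ → ℝ) : Prop :=
  ∀ ε : ℝ, 0 < ε → ∃ C : ℝ, 0 < C ∧ ∃ N : ℕ, ∀ n : ℕ, N ≤ n →
    P {ω | C * r n < |Z n ω|} ≤ ENNReal.ofReal ε

/-- The class `𝓜` of bounded, non-decreasing, right-continuous functions on `[0,1]`.
Functions are total on `ℝ`; values outside `[0,1]` are unconstrained and irrelevant. -/
def monoClass : Set (ℝ → ℝ) :=
  {m | MonotoneOn m (Icc 0 1) ∧ (∃ K : ℝ, ∀ x ∈ Icc (0 : ℝ) 1, |m x| ≤ K) ∧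
    ∀ x ∈ Icc (0 : ℝ) 1, ContinuousWithinAt m (Icc x 1) x}

/-- Empirical distribution function of the sample `y 0, …, y (n-1)`. -/
def empCDF (n : ℕ) (y : ℕ → ℝ) (t : ℝ) : ℝ :=
  (n : ℝ)⁻¹ * ∑ i ∈ Finset.range n, (Ici (y i)).indicator (fun _ => (1 : ℝ)) t

/-- The contrast `𝕄_n(m) = ∫ {ℍ_n(y) - n⁻¹ ∑ Φ_ε(y - m(X_i))}² dy`, where `Φ_ε` is the distribution
function of the noise law `ν`, `x` is the sample of covariates and `y` the sample of responses. -/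
def contrast (ν : Measure ℝ) (n : ℕ) (x y : ℕ → ℝ) (m : ℝ → ℝ) : ℝ :=
  ∫ t, (empCDF n y t - (n : ℝ)⁻¹ * ∑ i ∈ Finset.range n, cdf ν (t - m (x i))) ^ 2

/-- `m` is a minimum contrast estimator: it minimizes `𝕄_n` over the class `𝓜`. -/
def IsMinContrast (ν : Measure ℝ) (n : ℕ) (x y : ℕ → ℝ) (m : ℝ → ℝ) : Prop :=
  m ∈ monoClass ∧ IsMinOn (contrast ν n x y) monoClass m

/-- `w ↦ n⁻¹ ∑ 1{m(x_i) ≤ w}`. -/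
def empL (n : ℕ) (x : ℕ → ℝ) (m : ℝ → ℝ) (w : ℝ) : ℝ :=
  (n : ℝ)⁻¹ * ∑ i ∈ Finset.range n, {t | m t ≤ w}.indicator (fun _ => (1 : ℝ)) (x i)

/-- `w ↦ ∫ 1{m(x) ≤ w} dF₀(x)`, where `μ` is the probability law with distribution function `F₀`. -/
def popL (μ : Measure ℝ) (m : ℝ → ℝ) (w : ℝ) : ℝ :=
  ∫ t, {t | m t ≤ w}.indicator (fun _ => (1 : ℝ)) t ∂μ

/-- `φ_g(t) = ∫ e^{i t x} g(x) dx`. -/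
def phi (g : ℝ → ℝ) (t : ℝ) : ℂ :=
  ∫ x : ℝ, Complex.exp (Complex.I * t * x) * (g x : ℂ)

/-- `f` is a probability density of the law `ν` with respect to Lebesgue measure. -/
def IsDensityOf (f : ℝ → ℝ) (ν : Measure ℝ) : Prop :=
  Measurable f ∧ (∀ x, 0 ≤ f x) ∧ ν = volume.withDensity (fun x => ENNReal.ofReal (f x))

/-- Ordinary smoothness of order `β`: `d₀ / |t|^β ≤ |φ_f(t)| ≤ d₁ / |t|^β` as `|t| → ∞`. -/
def OrdinarySmooth (f : ℝ → ℝ) (β : ℝ) : Prop :=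
  ∃ d₀ d₁ R : ℝ, 0 < d₀ ∧ 0 < d₁ ∧ 0 < R ∧
    ∀ t : ℝ, R ≤ |t| → d₀ / |t| ^ β ≤ ‖phi f t‖ ∧ ‖phi f t‖ ≤ d₁ / |t| ^ β

/-- There is `T*` with `|φ_f(t)| ≥ |φ_f(T)| > 0` for all `T > T*` and `|t| ≤ T`. -/
def TailDominated (f : ℝ → ℝ) : Prop :=
  ∃ Tstar : ℝ, ∀ T : ℝ, Tstar < T → ∀ t : ℝ, |t| ≤ T →
    ‖phi f T‖ ≤ ‖phi f t‖ ∧ 0 < ‖phi f T‖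

end UnlinkedRegression

end

open UnlinkedRegression

/-! Uniform bounds. For monotone `m` the set `{m ≤ w}` is, on `[0,1]`, the trace of a lower set of
the line, i.e. of a half-line. So `empL - popL` is bounded, simultaneously in `w` and in `m` (hence
also at the random `mhat`), by the Kolmogorov–Smirnov distance of the covariate sample,
`abs_empL_sub_popL_le_ksDist`. Its square serves as both `Z` and `Z'`. A Chebyshev-type tail `2 / (n
l²)` suffices for `O_p(1/n)`: where `F ≤ 1/2` it comes from Kolmogorov's maximal inequality for a
martingale in the level `t` (`measureReal_exists_le_survSum_le`), and reflecting the sample covers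
the other levels.

Rate. Replace `m₀` by a right-continuous version `m₁`, so that it competes in the minimization. The
contrast is the squared `L²` distance between the empirical distribution function of the responses
and that of (empirical law of `m(X_i)`) `∗ ν`. Minimality against `m₁` and two triangle inequalities
bound the distance of the smoothed estimate from the truth by two integrated variances, both
`O_p(1/n)`; a first moment makes `∫ H (1 - H)` finite.

To undo the smoothing (`integral_cdf_sub_cdf_sq_le`), use Plancherel: convolution multiplies the
Fourier transform of a difference of distribution functions by the characteristic function of `ν`,
which is at least `d₀ T^(-β)` for `|t| ≤ T`; outside the band the transform is at most `1 / (π|ξ|)`.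
The total is of order `T^(2β) / n + 1 / T`, balanced by `T = n^(1/(2β+1))`. Passing from `empL` to
`popL` at `mhat` costs `(B - A)` times the squared Kolmogorov–Smirnov distance, which has the same
order. -/

/-! ### Plancherel's identity for the Fourier integral on `L¹ ∩ L²`. -/

section Plancherel

open FourierTransform SchwartzMap
open scoped ContDiff

/-- On `L¹ ∩ L²` the `L²`-Fourier transform is the Fourier integral. -/
theorem coeFn_fourier_toLp_ae_eq {g : ℝ → ℂ} (h1 : Integrable g) (h2 : MemLp g 2) :
    ((𝓕 (h2.toLp g) : Lp ℂ 2 (volume : Measure ℝ)) : ℝ → ℂ) =ᵐ[volume] 𝓕 g := by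
  have hcont : Continuous (𝓕 g) :=
    VectorFourier.fourierIntegral_continuous Real.continuous_fourierChar
      (by exact continuous_inner) h1
  -- Test against smooth compactly supported `φ`, viewed as Schwartz functions. The `L²` side moves
  -- the transform onto `ψ` by the definition for tempered distributions, the `L¹` side by Fubini.
  refine ae_eq_of_integral_contDiff_smul_eq
    ((Lp.memLp (𝓕 (h2.toLp g))).locallyIntegrable (by norm_num)) hcont.locallyIntegrable
    fun φ hφ hφc => ?_
  have hφ' : ContDiff ℝ ∞ (fun x => (φ x : ℂ)) := Complex.ofRealCLM.contDiff.comp hφ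
  have hφc' : HasCompactSupport (fun x => (φ x : ℂ)) :=
    hφc.comp_left (g := fun x : ℝ => (x : ℂ)) Complex.ofReal_zero
  let ψ : 𝓢(ℝ, ℂ) := hφc'.toSchwartzMap hφ'
  have hψ : ∀ x, ψ x = (φ x : ℂ) := fun x => rfl
  have key := congrArg (fun T : TemperedDistribution ℝ ℂ => T ψ)
    (Lp.fourier_toTemperedDistribution_eq (h2.toLp g))
  simp only [TemperedDistribution.fourier_apply, Lp.toTemperedDistribution_apply] at key
  have e1 : ∫ x, φ x • ((𝓕 (h2.toLp g) : Lp ℂ 2 (volume : Measure ℝ)) : ℝ → ℂ) x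
      = ∫ x, ψ x • ((𝓕 (h2.toLp g) : Lp ℂ 2 (volume : Measure ℝ)) : ℝ → ℂ) x := by
    simp [hψ]
  have e2 : ∫ x, φ x • 𝓕 g x = ∫ x, ψ x • 𝓕 g x := by simp [hψ]
  rw [e1, e2, ← key]
  have e3 : ∫ x, 𝓕 ψ x • (h2.toLp g) x = ∫ x, 𝓕 ψ x • g x := by
    refine integral_congr_ae ?_
    filter_upwards [h2.coeFn_toLp] with x hx
    rw [hx]
  rw [e3]
  rw [SchwartzMap.fourier_coe]
  simpa using! VectorFourier.integral_fourierIntegral_smul_eq_flip (L := innerₗ ℝ)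
    Real.continuous_fourierChar (by exact continuous_inner) (ψ.integrable (μ := volume)) h1

theorem integral_norm_fourier_sq_eq {g : ℝ → ℂ} (h1 : Integrable g) (h2 : MemLp g 2) :
    Integrable (fun ξ => ‖𝓕 g ξ‖ ^ 2) ∧ ∫ ξ, ‖𝓕 g ξ‖ ^ 2 = ∫ x, ‖g x‖ ^ 2 := by
  have hF := coeFn_fourier_toLp_ae_eq h1 h2
  have hmem : MemLp (𝓕 g) 2 := (memLp_congr_ae hF).1 (Lp.memLp _)
  refine ⟨hmem.integrable_norm_pow (by norm_num), ?_⟩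
  have hn : eLpNorm (𝓕 g) 2 = eLpNorm g 2 := by
    have h := congrArg ENNReal.ofReal (Lp.norm_fourier_eq (h2.toLp g))
    rw [ofReal_norm, ofReal_norm, Lp.enorm_def, Lp.enorm_def, eLpNorm_congr_ae hF,
      eLpNorm_congr_ae h2.coeFn_toLp] at h
    exact h
  have hpow : ∀ {u : ℝ → ℂ}, MemLp u 2 → ∫ x, ‖u x‖ ^ 2 = (eLpNorm u 2).toReal ^ 2 := by
    intro u hu
    rw [hu.eLpNorm_eq_integral_rpow_norm (by norm_num) (by norm_num),
      ENNReal.toReal_ofReal (by positivity)]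
    norm_num
    rw [← Real.sqrt_eq_rpow, Real.sq_sqrt (by positivity)]
  rw [hpow hmem, hpow h2, hn]

theorem integral_norm_fourier_ofReal_sq_eq {g : ℝ → ℝ} (h1 : Integrable g) (h2 : MemLp g 2) :
    Integrable (fun ξ => ‖𝓕 (fun x => (g x : ℂ)) ξ‖ ^ 2) ∧
      ∫ ξ, ‖𝓕 (fun x => (g x : ℂ)) ξ‖ ^ 2 = ∫ x, g x ^ 2 := by
  have h := integral_norm_fourier_sq_eq (g := fun x => (g x : ℂ)) h1.ofReal (h2.ofReal (K := ℂ))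
  simpa using h

end Plancherel

/-! ### Fourier transform of a difference of distribution functions. -/

section CdfDifference

/-- The distribution function of the point mass at `a`. -/
noncomputable abbrev stepAt (a w : ℝ) : ℝ := (Ici a).indicator (fun _ => (1 : ℝ)) w

theorem measurable_uncurry_stepAt : Measurable (Function.uncurry stepAt) := by
  have : Function.uncurry stepAt = {p : ℝ × ℝ | p.1 ≤ p.2}.indicator (fun _ => (1 : ℝ)) := by
    ext ⟨a, w⟩
    simp [Function.uncurry, stepAt, indicator]
  rw [this]
  exact measurable_const.indicator (measurableSet_le measurable_fst measurable_snd)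

theorem measurable_stepAt (a : ℝ) : Measurable (stepAt a) :=
  measurable_const.indicator measurableSet_Ici

theorem stepAt_eq_indicator_Iic (a w : ℝ) : stepAt a w = (Iic w).indicator (fun _ => (1 : ℝ)) a := by
  simp [stepAt, indicator]

theorem cdf_eq_integral_stepAt (p : Measure ℝ) [IsProbabilityMeasure p] (w : ℝ) :
    cdf p w = ∫ a, stepAt a w ∂p := by
  simp_rw [stepAt_eq_indicator_Iic]
  rw [integral_indicator measurableSet_Iic, cdf_eq_real]
  simp

/-- The integrand is the indicator of the interval between `0` and `a`. This is how a first moment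
becomes integrability of `cdf p - stepAt 0`. -/
theorem lintegral_enorm_stepAt_sub (a : ℝ) : ∫⁻ w, ‖stepAt a w - stepAt 0 w‖ₑ = ‖a‖ₑ := by
  have : ∀ w, ‖stepAt a w - stepAt 0 w‖ₑ = (Ico (min a 0) (max a 0)).indicator 1 w := by
    intro w
    simp only [stepAt, indicator, mem_Ici, mem_Ico, Pi.one_apply]
    split_ifs <;> simp_all <;> grind
  simp_rw [this]
  rw [lintegral_indicator_one measurableSet_Ico, Real.volume_Ico, max_sub_min_eq_abs, zero_sub,
    abs_neg, ← Real.norm_eq_abs, ofReal_norm]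

/-- Up to sign the step difference is the indicator of the interval from `a` to `0`. Keeping the
factor `c` on the left avoids a division and includes `c = 0`. -/
theorem mul_integral_exp_mul_stepAt_sub (a : ℝ) (c : ℂ) :
    c * ∫ w : ℝ, Complex.exp (-c * w) * ((stepAt a w - stepAt 0 w : ℝ) : ℂ) =
      Complex.exp (-c * a) - 1 := by
  have hrep : (∫ w : ℝ, Complex.exp (-c * w) * ((stepAt a w - stepAt 0 w : ℝ) : ℂ))
      = ∫ w in a..0, Complex.exp (-c * w) := by
    rcases le_total a 0 with h | h
    · rw [intervalIntegral.integral_of_le h, ← integral_Ico_eq_integral_Ioc,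
        ← integral_indicator measurableSet_Ico]
      congr 1; ext w
      simp only [stepAt, indicator, mem_Ici, mem_Ico]
      split_ifs <;> first | (exfalso; grind) | simp
    · rw [intervalIntegral.integral_of_ge h, ← integral_Ico_eq_integral_Ioc,
        ← integral_indicator measurableSet_Ico, ← integral_neg]
      congr 1; ext w
      simp only [stepAt, indicator, mem_Ici, mem_Ico]
      split_ifs <;> first | (exfalso; grind) | simp
  rw [hrep]
  by_cases h0 : c = 0
  · simp [h0]
  · rw [integral_exp_mul_complex (neg_ne_zero.2 h0)]
    field_simp
    simp

theorem integrable_prod_stepAt_sub {p : Measure ℝ} [SFinite p] (hp : Integrable (fun x : ℝ => x) p) :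
    Integrable (fun z : ℝ × ℝ => stepAt z.1 z.2 - stepAt 0 z.2) (p.prod volume) := by
  have hm : Measurable (fun z : ℝ × ℝ => stepAt z.1 z.2 - stepAt 0 z.2) :=
    measurable_uncurry_stepAt.sub ((measurable_stepAt 0).comp measurable_snd)
  refine ⟨hm.aestronglyMeasurable, ?_⟩
  rw [HasFiniteIntegral, lintegral_prod _ (hm.enorm.aemeasurable)]
  simp_rw [lintegral_enorm_stepAt_sub]
  exact hp.2

theorem abs_cdf_sub_cdf_le_one (p q : Measure ℝ) (w : ℝ) : |cdf p w - cdf q w| ≤ 1 := by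
  rw [abs_le]
  constructor <;> linarith [cdf_nonneg p w, cdf_nonneg q w, cdf_le_one p w, cdf_le_one q w]

variable {p q : Measure ℝ} [IsProbabilityMeasure p] [IsProbabilityMeasure q]

theorem integrable_stepAt (w : ℝ) : Integrable (fun a => stepAt a w) p := by
  simp_rw [stepAt_eq_indicator_Iic]
  exact (integrable_const 1).indicator measurableSet_Iic

theorem cdf_sub_stepAt_zero (w : ℝ) :
    cdf p w - stepAt 0 w = ∫ a, (stepAt a w - stepAt 0 w) ∂p := by
  rw [integral_sub (integrable_stepAt w) (integrable_const _), cdf_eq_integral_stepAt]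
  simp

theorem integrable_cdf_sub_stepAt_zero (hp : Integrable (fun x : ℝ => x) p) :
    Integrable (fun w => cdf p w - stepAt 0 w) := by
  simp_rw [cdf_sub_stepAt_zero]
  exact (integrable_prod_stepAt_sub hp).integral_prod_right

/-- Integration by parts in disguise: average the point-mass identity over `p` and swap integrals.
Subtracting the step at `0` supplies the integrability that `cdf p` alone lacks. -/
theorem mul_integral_exp_mul_cdf_sub_stepAt_zero (hp : Integrable (fun x : ℝ => x) p) (t : ℝ) :
    (t * Complex.I) * ∫ w : ℝ, Complex.exp (-(t * Complex.I) * w) *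
      ((cdf p w - stepAt 0 w : ℝ) : ℂ) = charFun p (-t) - 1 := by
  have hnorm : ∀ w : ℝ, ‖Complex.exp (-(t * Complex.I) * w)‖ = 1 := by
    intro w
    rw [Complex.norm_exp]
    simp
  have hint : Integrable (fun z : ℝ × ℝ => Complex.exp (-(t * Complex.I) * z.2) *
      ((stepAt z.1 z.2 - stepAt 0 z.2 : ℝ) : ℂ)) (p.prod volume) := by
    refine (integrable_prod_stepAt_sub hp).ofReal.bdd_mul (c := 1)
      (by fun_prop) (Filter.Eventually.of_forall fun z => (hnorm z.2).le)
  have h1 : ∀ w : ℝ, Complex.exp (-(t * Complex.I) * w) * ((cdf p w - stepAt 0 w : ℝ) : ℂ)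
      = ∫ a, Complex.exp (-(t * Complex.I) * w) * ((stepAt a w - stepAt 0 w : ℝ) : ℂ) ∂p := by
    intro w
    rw [cdf_sub_stepAt_zero, integral_const_mul, integral_complex_ofReal]
  simp_rw [h1]
  rw [← integral_integral_swap (f := fun a w : ℝ => Complex.exp (-(t * Complex.I) * w) *
      ((stepAt a w - stepAt 0 w : ℝ) : ℂ)) hint, ← integral_const_mul]
  simp_rw [mul_integral_exp_mul_stepAt_sub]
  rw [integral_sub _ (integrable_const _), charFun_apply_real]
  · simp only [integral_const, probReal_univ, one_smul]
    congr 2; ext x; congr 1; push_cast; ring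
  · refine Integrable.of_bound (by fun_prop) 1 (Filter.Eventually.of_forall fun x => (hnorm x).le)

theorem integrable_cdf_sub_cdf (hp : Integrable (fun x : ℝ => x) p)
    (hq : Integrable (fun x : ℝ => x) q) : Integrable (fun w => cdf p w - cdf q w) := by
  refine ((integrable_cdf_sub_stepAt_zero hp).sub (integrable_cdf_sub_stepAt_zero hq)).congr
    (Filter.Eventually.of_forall fun w => ?_)
  simp

theorem memLp_two_of_integrable_of_abs_le_one {g : ℝ → ℝ} (h : Integrable g)
    (hb : ∀ w, |g w| ≤ 1) : MemLp g 2 := by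
  rw [memLp_two_iff_integrable_sq h.1]
  refine h.norm.mono' (h.1.pow 2) (Filter.Eventually.of_forall fun w => ?_)
  rw [norm_pow, Real.norm_eq_abs, sq]
  exact mul_le_of_le_one_left (abs_nonneg _) (hb w)

theorem memLp_two_cdf_sub_cdf (hp : Integrable (fun x : ℝ => x) p)
    (hq : Integrable (fun x : ℝ => x) q) : MemLp (fun w => cdf p w - cdf q w) 2 :=
  memLp_two_of_integrable_of_abs_le_one (integrable_cdf_sub_cdf hp hq) (abs_cdf_sub_cdf_le_one p q)

open FourierTransform in
theorem mul_fourier_cdf_sub_cdf (hp : Integrable (fun x : ℝ => x) p)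
    (hq : Integrable (fun x : ℝ => x) q) (ξ : ℝ) :
    ((2 * Real.pi * ξ : ℝ) * Complex.I) * 𝓕 (fun w => ((cdf p w - cdf q w : ℝ) : ℂ)) ξ =
      charFun p (-(2 * Real.pi * ξ)) - charFun q (-(2 * Real.pi * ξ)) := by
  have hnorm : ∀ w : ℝ, ‖Complex.exp (-((2 * Real.pi * ξ : ℝ) * Complex.I) * w)‖ = 1 := by
    intro w
    rw [Complex.norm_exp]
    simp
  have hi : ∀ {r : Measure ℝ} [IsProbabilityMeasure r], Integrable (fun x : ℝ => x) r →
      Integrable fun w : ℝ => Complex.exp (-((2 * Real.pi * ξ : ℝ) * Complex.I) * w) *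
        ((cdf r w - stepAt 0 w : ℝ) : ℂ) := fun hr =>
    (integrable_cdf_sub_stepAt_zero hr).ofReal.bdd_mul (c := 1) (by fun_prop)
      (Filter.Eventually.of_forall fun z => (hnorm z).le)
  have e : 𝓕 (fun w => ((cdf p w - cdf q w : ℝ) : ℂ)) ξ =
      (∫ w : ℝ, Complex.exp (-((2 * Real.pi * ξ : ℝ) * Complex.I) * w) *
        ((cdf p w - stepAt 0 w : ℝ) : ℂ)) -
      ∫ w : ℝ, Complex.exp (-((2 * Real.pi * ξ : ℝ) * Complex.I) * w) *
        ((cdf q w - stepAt 0 w : ℝ) : ℂ) := by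
    rw [← integral_sub (hi hp) (hi hq), Real.fourier_real_eq_integral_exp_smul]
    congr 1; ext w
    rw [smul_eq_mul, ← mul_sub]
    congr 1
    · congr 1; push_cast; ring
    · push_cast; ring
  rw [e, mul_sub, mul_integral_exp_mul_cdf_sub_stepAt_zero hp,
    mul_integral_exp_mul_cdf_sub_stepAt_zero hq]
  ring

end CdfDifference

/-! ### Deconvolution in `L²`. -/

section Deconvolution

open FourierTransform

theorem integrable_id_conv {p ν : Measure ℝ} [IsProbabilityMeasure p] [IsProbabilityMeasure ν]
    (hp : Integrable (fun x : ℝ => x) p) (hν : Integrable (fun x : ℝ => x) ν) :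
    Integrable (fun x : ℝ => x) (p ∗ ν) := by
  rw [Measure.conv, integrable_map_measure (by fun_prop) (by fun_prop)]
  exact (hp.comp_fst ν).add (hν.comp_snd p)

theorem integral_tail_inv_sq {S : ℝ} (hS : 0 < S) :
    Integrable ((Ioi S).indicator fun x : ℝ => x ^ (-2 : ℝ)) ∧
      ∫ x, (Ioi S).indicator (fun x : ℝ => x ^ (-2 : ℝ)) x = S⁻¹ := by
  refine ⟨(integrableOn_Ioi_rpow_of_lt (by norm_num) hS).integrable_indicator measurableSet_Ioi, ?_⟩
  rw [integral_indicator measurableSet_Ioi, integral_Ioi_rpow_of_lt (by norm_num) hS]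
  norm_num
  exact Real.rpow_neg_one S

variable {p q ν : Measure ℝ} [IsProbabilityMeasure p] [IsProbabilityMeasure q]
  [IsProbabilityMeasure ν]

theorem norm_fourier_cdf_sub_cdf_le (hp : Integrable (fun x : ℝ => x) p)
    (hq : Integrable (fun x : ℝ => x) q) {ξ : ℝ} (hξ : ξ ≠ 0) :
    ‖𝓕 (fun w => ((cdf p w - cdf q w : ℝ) : ℂ)) ξ‖ ≤ (Real.pi * |ξ|)⁻¹ := by
  have h := congrArg norm (mul_fourier_cdf_sub_cdf hp hq ξ)
  have h2 : ‖charFun p (-(2 * Real.pi * ξ)) - charFun q (-(2 * Real.pi * ξ))‖ ≤ 2 := by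
    refine (norm_sub_le _ _).trans ?_
    linarith [norm_charFun_le_one (μ := p) (-(2 * Real.pi * ξ)),
      norm_charFun_le_one (μ := q) (-(2 * Real.pi * ξ))]
  rw [norm_mul, norm_mul, Complex.norm_I, mul_one, Complex.norm_real, Real.norm_eq_abs, abs_mul,
    abs_of_pos Real.two_pi_pos] at h
  have hpos : 0 < Real.pi * |ξ| := mul_pos Real.pi_pos (abs_pos.2 hξ)
  rw [← one_div, le_div_iff₀ hpos]
  nlinarith

/-- After multiplication by `2πiξ` this is multiplicativity of characteristic functions; `ξ ≠ 0`
allows the factor to be cancelled. -/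
theorem fourier_cdf_conv_sub_cdf_conv (hp : Integrable (fun x : ℝ => x) p)
    (hq : Integrable (fun x : ℝ => x) q) (hν : Integrable (fun x : ℝ => x) ν) {ξ : ℝ}
    (hξ : ξ ≠ 0) :
    𝓕 (fun w => ((cdf (p ∗ ν) w - cdf (q ∗ ν) w : ℝ) : ℂ)) ξ =
      𝓕 (fun w => ((cdf p w - cdf q w : ℝ) : ℂ)) ξ * charFun ν (-(2 * Real.pi * ξ)) := by
  have h := mul_fourier_cdf_sub_cdf (integrable_id_conv hp hν) (integrable_id_conv hq hν) ξ
  have h0 : ((2 * Real.pi * ξ : ℝ) * Complex.I) ≠ 0 := by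
    simp [Real.pi_ne_zero, hξ]
  refine mul_left_cancel₀ h0 ?_
  rw [h, ← mul_assoc, mul_fourier_cdf_sub_cdf hp hq, charFun_conv, charFun_conv]
  ring

/-- Deconvolution inequality for distribution functions: smoothing by `ν` cannot shrink the
`L²`-distance by more than the size of the characteristic function of `ν` on a frequency band, up
to the contribution of the frequencies outside of the band. -/
theorem integral_cdf_sub_cdf_sq_le (hp : Integrable (fun x : ℝ => x) p)
    (hq : Integrable (fun x : ℝ => x) q) (hν : Integrable (fun x : ℝ => x) ν) {c S : ℝ}
    (hc : 0 < c) (hS : 0 < S) (h : ∀ ξ, |ξ| ≤ S → c ≤ ‖charFun ν (-(2 * Real.pi * ξ))‖) :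
    ∫ w, (cdf p w - cdf q w) ^ 2 ≤
      (c ^ 2)⁻¹ * (∫ w, (cdf (p ∗ ν) w - cdf (q ∗ ν) w) ^ 2) + 2 / (Real.pi ^ 2 * S) := by
  obtain ⟨hi1, he1⟩ := integral_norm_fourier_ofReal_sq_eq (integrable_cdf_sub_cdf hp hq)
    (memLp_two_cdf_sub_cdf hp hq)
  have hp' := integrable_id_conv hp hν
  have hq' := integrable_id_conv hq hν
  obtain ⟨hi2, he2⟩ := integral_norm_fourier_ofReal_sq_eq (integrable_cdf_sub_cdf hp' hq')
    (memLp_two_cdf_sub_cdf hp' hq')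
  rw [← he1, ← he2]
  obtain ⟨hk, hk'⟩ := integral_tail_inv_sq hS
  -- `k ξ + k (-ξ)` is `ξ⁻²` outside the band, with total mass `2 / S`; it dominates the
  -- uncontrolled frequencies.
  set k : ℝ → ℝ := (Ioi S).indicator fun x : ℝ => x ^ (-2 : ℝ) with hkdef
  have hk0 : ∀ x, 0 ≤ k x := fun x =>
    indicator_nonneg (fun y hy => Real.rpow_nonneg (hS.trans hy).le _) x
  have hkn : Integrable fun x => k (-x) := hk.comp_neg
  have hks : Integrable fun x => (Real.pi ^ 2)⁻¹ * (k x + k (-x)) := (hk.add hkn).const_mul _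
  have hbound : ∀ᵐ ξ : ℝ, ‖𝓕 (fun w => ((cdf p w - cdf q w : ℝ) : ℂ)) ξ‖ ^ 2 ≤
      (c ^ 2)⁻¹ * ‖𝓕 (fun w => ((cdf (p ∗ ν) w - cdf (q ∗ ν) w : ℝ) : ℂ)) ξ‖ ^ 2 +
        (Real.pi ^ 2)⁻¹ * (k ξ + k (-ξ)) := by
    have h0 : ∀ᵐ ξ : ℝ, ξ ≠ 0 := Measure.ae_ne volume 0
    filter_upwards [h0] with ξ hξ
    by_cases hξS : |ξ| ≤ S
    · rw [fourier_cdf_conv_sub_cdf_conv hp hq hν hξ, norm_mul, mul_pow]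
      have h1 : c ^ 2 ≤ ‖charFun ν (-(2 * Real.pi * ξ))‖ ^ 2 :=
        pow_le_pow_left₀ hc.le (h ξ hξS) 2
      set G := ‖𝓕 (fun w => ((cdf p w - cdf q w : ℝ) : ℂ)) ξ‖ ^ 2
      have hG : 0 ≤ G := by positivity
      have h2 : G ≤ (c ^ 2)⁻¹ * (G * ‖charFun ν (-(2 * Real.pi * ξ))‖ ^ 2) := by
        rw [inv_mul_eq_div, le_div_iff₀ (by positivity)]
        exact mul_le_mul_of_nonneg_left h1 hG
      have h3 : 0 ≤ (Real.pi ^ 2)⁻¹ * (k ξ + k (-ξ)) :=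
        mul_nonneg (by positivity) (add_nonneg (hk0 _) (hk0 _))
      linarith
    · have h1 := norm_fourier_cdf_sub_cdf_le hp hq hξ
      have h2 : ‖𝓕 (fun w => ((cdf p w - cdf q w : ℝ) : ℂ)) ξ‖ ^ 2 ≤
          (Real.pi ^ 2)⁻¹ * (ξ ^ 2)⁻¹ := by
        refine (pow_le_pow_left₀ (norm_nonneg _) h1 2).trans_eq ?_
        rw [inv_pow, mul_pow, sq_abs, mul_inv]
      have h3 : (ξ ^ 2)⁻¹ ≤ k ξ + k (-ξ) := by
        rcases lt_abs.1 (not_le.1 hξS) with hlt | hlt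
        · have : k ξ = (ξ ^ 2)⁻¹ := by
            rw [hkdef, indicator_of_mem (show ξ ∈ Ioi S from hlt), Real.rpow_neg (hS.trans hlt).le]
            norm_num
          linarith [hk0 (-ξ)]
        · have : k (-ξ) = (ξ ^ 2)⁻¹ := by
            rw [hkdef, indicator_of_mem (show -ξ ∈ Ioi S from hlt),
              Real.rpow_neg (hS.trans hlt).le]
            norm_num
          linarith [hk0 ξ]
      have h4 : 0 ≤ (c ^ 2)⁻¹ *
          ‖𝓕 (fun w => ((cdf (p ∗ ν) w - cdf (q ∗ ν) w : ℝ) : ℂ)) ξ‖ ^ 2 := by positivity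
      have h5 := mul_le_mul_of_nonneg_left h3 (show 0 ≤ (Real.pi ^ 2)⁻¹ by positivity)
      linarith
  refine (integral_mono_ae hi1 ((hi2.const_mul _).add hks) hbound).trans_eq ?_
  simp only [Pi.add_apply]
  rw [integral_add (hi2.const_mul _) hks, integral_const_mul, integral_const_mul,
    integral_add hk hkn, integral_neg_eq_self k, hk']
  congr 1
  field_simp
  norm_num

end Deconvolution

/-! ### Second moment of a sum of pairwise independent variables. -/

section SecondMoment

variable {Ω : Type*} [MeasurableSpace Ω] {P : Measure Ω} [IsProbabilityMeasure P]

theorem integral_sum_sub_sq_eq {Z : ℕ → Ω → ℝ} (hZ : ∀ i, MemLp (Z i) 2 P)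
    (hind : Pairwise fun i j => IndepFun (Z i) (Z j) P) {c : ℝ} (hc : ∀ i, ∫ ω, Z i ω ∂P = c)
    (n : ℕ) :
    ∫ ω, (∑ i ∈ Finset.range n, (Z i ω - c)) ^ 2 ∂P = ∑ i ∈ Finset.range n, variance (Z i) P := by
  rw [← IndepFun.variance_sum (fun i _ => hZ i) (hind.set_pairwise _), variance_eq_integral
    (Finset.aemeasurable_sum _ fun i _ => (hZ i).aemeasurable)]
  congr 1; ext ω
  simp only [Finset.sum_apply]
  rw [integral_finsetSum _ fun i _ => (hZ i).integrable one_le_two, Finset.sum_sub_distrib]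
  simp [hc]

end SecondMoment

/-! ### A maximal inequality for the empirical process. -/

section FirstCrossing

/-- The sum over the sample of `1 - 1{x i > t} / (1 - F t)`, a martingale in `t`. -/
noncomputable def survSum (F : ℝ → ℝ) (n : ℕ) (t : ℝ) (x : ℕ → ℝ) : ℝ :=
  ∑ i ∈ Finset.range n, (1 - (Ioi t).indicator (fun _ => (1 - F t)⁻¹) (x i))

theorem measurable_survSum (F : ℝ → ℝ) (n : ℕ) (t : ℝ) : Measurable (survSum F n t) := by
  refine Finset.measurable_sum _ fun i _ => measurable_const.sub ?_
  exact (measurable_const.indicator measurableSet_Ioi).comp (measurable_pi_apply i)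

theorem abs_survSum_le (F : ℝ → ℝ) (n : ℕ) (t : ℝ) (x : ℕ → ℝ) :
    |survSum F n t x| ≤ n * (1 + |(1 - F t)⁻¹|) := by
  refine (Finset.abs_sum_le_sum_abs _ _).trans ?_
  refine (Finset.sum_le_card_nsmul _ _ (1 + |(1 - F t)⁻¹|) fun i _ => ?_).trans_eq (by simp; ring)
  have h : |(Ioi t).indicator (fun _ => (1 - F t)⁻¹) (x i)| ≤ |(1 - F t)⁻¹| := by
    simp only [indicator]
    split_ifs <;> simp
  refine (abs_sub _ _).trans ?_
  rw [abs_one]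
  linarith

/-- Holds term by term. Since `0 ≤ 1 - F t ≤ 1` for a distribution function, control of the
martingale controls the empirical process. -/
theorem empCDF_sub_eq {F : ℝ → ℝ} {n : ℕ} (hn : n ≠ 0) {t : ℝ} (ht : F t < 1) (x : ℕ → ℝ) :
    empCDF n x t - F t = (1 - F t) * ((n : ℝ)⁻¹ * survSum F n t x) := by
  have h1 : (1 - F t) ≠ 0 := (sub_pos.2 ht).ne'
  have h : ∀ i, (1 - F t) * (1 - (Ioi t).indicator (fun _ => (1 - F t)⁻¹) (x i)) =
      (Ici (x i)).indicator (fun _ => (1 : ℝ)) t - F t := by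
    intro i
    simp only [indicator, mem_Ioi, mem_Ici]
    split_ifs with h1 h2 h2
    · exact absurd h2 (not_le.2 h1)
    · field_simp; ring
    · ring
    · exact absurd (not_lt.1 h1) h2
  rw [survSum, mul_left_comm, Finset.mul_sum]
  simp_rw [h]
  rw [Finset.sum_sub_distrib, mul_sub, empCDF]
  simp
  field_simp

variable {Ω : Type*} [MeasurableSpace Ω] {P : Measure Ω} {μ : Measure ℝ} {X : ℕ → Ω → ℝ}

/-- The hypothesis `hloc` says that `φ` does not see the value of a coordinate beyond `t`, while `h`
lives only beyond `t`. So in the product the coordinate `i` of `φ` can be frozen at a value above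
`t`; then `φ` is independent of `h (X i)`, which has mean zero. This replaces conditioning on a
filtration. -/
theorem integral_mul_eq_zero_of_stopped (hX : ∀ i, Measurable (X i)) (hind : iIndepFun X P)
    (hlaw : ∀ i, P.map (X i) = μ) {n : ℕ} {t : ℝ} {φ : (ℕ → ℝ) → ℝ} (hφ : Measurable φ)
    (hloc : ∀ x y : ℕ → ℝ, (∀ j < n, x j = y j ∨ (t < x j ∧ t < y j)) → φ x = φ y)
    {h : ℝ → ℝ} (hh : Measurable h) (h0 : ∀ x ≤ t, h x = 0) (hmean : ∫ x, h x ∂μ = 0)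
    (i : ℕ) : ∫ ω, φ (fun j => X j ω) * h (X i ω) ∂P = 0 := by
  classical
  set T : Finset ℕ := (Finset.range n).erase i
  -- Any filler above `t` would do for coordinate `i`; coordinates from `n` on do not affect `φ`.
  let ext : (T → ℝ) → (ℕ → ℝ) := fun z j => if hj : j ∈ T then z ⟨j, hj⟩ else t + 1
  have hext : Measurable ext := by
    refine measurable_pi_lambda _ fun j => ?_
    by_cases hj : j ∈ T
    · simp only [ext, hj, dite_true]
      exact measurable_pi_apply _
    · simp only [ext, hj, dite_false]
      exact measurable_const
  have hpt : ∀ ω, φ (fun j => X j ω) * h (X i ω) =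
      φ (ext fun j => X j ω) * h (X i ω) := by
    intro ω
    rcases le_or_gt (X i ω) t with hle | hlt
    · simp [h0 _ hle]
    · congr 1
      refine hloc _ _ fun j hj => ?_
      by_cases hji : j = i
      · right
        subst hji
        refine ⟨hlt, ?_⟩
        simp [ext, T]
      · left
        simp [ext, T, hji, hj]
  simp_rw [hpt]
  have hI : IndepFun (fun ω (j : T) => X j ω) (X i) P := by
    have := (hind.indepFun_finset T {i} (by simp [T]) hX).comp measurable_id
      (measurable_pi_apply (⟨i, by simp⟩ : ({i} : Finset ℕ)))
    exact this
  have hI' : IndepFun (fun ω => φ (ext fun j => X j ω)) (fun ω => h (X i ω)) P :=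
    hI.comp (hφ.comp hext) hh
  have hmX : Measurable fun ω => (fun j : T => X j ω) := measurable_pi_lambda _ fun j => hX j
  rw [hI'.integral_fun_mul_eq_mul_integral
    ((hφ.comp hext).comp hmX).aestronglyMeasurable (hh.comp (hX i)).aestronglyMeasurable]
  have : ∫ ω, h (X i ω) ∂P = 0 := by
    rw [← hmean, ← hlaw i, integral_map (hX i).aemeasurable hh.aestronglyMeasurable]
  rw [this, mul_zero]

variable [IsProbabilityMeasure P] [IsProbabilityMeasure μ]

theorem integral_indicator_Ioi_inv {t : ℝ} (ht : cdf μ t < 1) :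
    ∫ x, (Ioi t).indicator (fun _ => (1 - cdf μ t)⁻¹) x ∂μ = 1 := by
  have h1 : (1 - cdf μ t) ≠ 0 := (sub_pos.2 ht).ne'
  have h2 : μ.real (Ioi t) = 1 - cdf μ t := by
    rw [cdf_eq_real, ← compl_Iic, probReal_compl_eq_one_sub measurableSet_Iic]
  rw [integral_indicator measurableSet_Ioi]
  simp [h2, h1]

/-- Orthogonality of martingale increments: each summand of the increment vanishes on `x ≤ t` and
has mean `1 - 1 = 0`. -/
theorem integral_mul_survSum_sub_eq_zero (hX : ∀ i, Measurable (X i)) (hind : iIndepFun X P)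
    (hlaw : ∀ i, P.map (X i) = μ) {n : ℕ} {t T : ℝ} (htT : t ≤ T) (hT : cdf μ T < 1)
    {φ : (ℕ → ℝ) → ℝ} (hφ : Measurable φ) {K : ℝ} (hK : ∀ x, |φ x| ≤ K)
    (hloc : ∀ x y : ℕ → ℝ, (∀ j < n, x j = y j ∨ (t < x j ∧ t < y j)) → φ x = φ y) :
    ∫ ω, φ (fun j => X j ω) * (survSum (cdf μ) n T (fun j => X j ω) -
      survSum (cdf μ) n t (fun j => X j ω)) ∂P = 0 := by
  set g : ℝ → ℝ → ℝ := fun s => (Ioi s).indicator (fun _ => (1 - cdf μ s)⁻¹) with hg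
  have hgm : ∀ s, Measurable (g s) := fun s => measurable_const.indicator measurableSet_Ioi
  have hgb : ∀ s x, |g s x| ≤ |(1 - cdf μ s)⁻¹| := by
    intro s x
    simp only [hg, indicator]
    split_ifs <;> simp
  have hXv : Measurable fun ω => (fun j => X j ω) := measurable_pi_lambda _ hX
  have hsum : ∀ ω, φ (fun j => X j ω) * (survSum (cdf μ) n T (fun j => X j ω) -
      survSum (cdf μ) n t (fun j => X j ω)) =
      ∑ i ∈ Finset.range n, φ (fun j => X j ω) * (g t (X i ω) - g T (X i ω)) := by
    intro ω
    rw [survSum, survSum, ← Finset.sum_sub_distrib, Finset.mul_sum]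
    refine Finset.sum_congr rfl fun i _ => ?_
    ring
  simp_rw [hsum]
  rw [integral_finsetSum]
  · refine Finset.sum_eq_zero fun i _ => ?_
    refine integral_mul_eq_zero_of_stopped hX hind hlaw hφ hloc
      (h := fun x => g t x - g T x) ((hgm t).sub (hgm T)) (fun x hx => ?_) ?_ i
    · simp [hg, hx, hx.trans htT]
    · rw [integral_sub, integral_indicator_Ioi_inv hT,
        integral_indicator_Ioi_inv ((monotone_cdf μ htT).trans_lt hT), sub_self]
      · exact (integrable_const _).indicator measurableSet_Ioi
      · exact (integrable_const _).indicator measurableSet_Ioi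
  · intro i _
    refine Integrable.of_bound (C := K * (|(1 - cdf μ t)⁻¹| + |(1 - cdf μ T)⁻¹|))
      ((hφ.comp hXv).mul
        (((hgm t).comp (hX i)).sub ((hgm T).comp (hX i)))).aestronglyMeasurable
      (Filter.Eventually.of_forall fun ω => ?_)
    rw [norm_mul, Real.norm_eq_abs, Real.norm_eq_abs]
    refine mul_le_mul (hK _) ((abs_sub _ _).trans (add_le_add (hgb _ _) (hgb _ _)))
      (abs_nonneg _) ((abs_nonneg _).trans (hK 0))

/-- As `F T ≤ 1/2`, the variable `1{X > T} / (1 - F T)` lies in `[0, 2]` with mean `1`, so its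
variance is at most `(2 - 1)(1 - 0) = 1`. -/
theorem integral_survSum_sq_le (hX : ∀ i, Measurable (X i)) (hind : iIndepFun X P)
    (hlaw : ∀ i, P.map (X i) = μ) (n : ℕ) {T : ℝ} (hT : cdf μ T ≤ 1 / 2) :
    ∫ ω, survSum (cdf μ) n T (fun j => X j ω) ^ 2 ∂P ≤ n := by
  have hpos : 0 < 1 - cdf μ T := by linarith
  have hinv : (1 - cdf μ T)⁻¹ ≤ 2 := by
    rw [inv_le_comm₀ hpos two_pos]; linarith
  set g : ℝ → ℝ := (Ioi T).indicator (fun _ => (1 - cdf μ T)⁻¹) with hg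
  have hgm : Measurable g := measurable_const.indicator measurableSet_Ioi
  have hg0 : ∀ x, 0 ≤ g x := fun x => indicator_nonneg (fun _ _ => (inv_pos.2 hpos).le) x
  have hg2 : ∀ x, g x ≤ 2 := by
    intro x
    simp only [hg, indicator]
    split_ifs
    · exact hinv
    · norm_num
  have hmean : ∀ i, ∫ ω, g (X i ω) ∂P = 1 := by
    intro i
    rw [← integral_map (φ := X i) (hX i).aemeasurable hgm.aestronglyMeasurable, hlaw i]
    exact integral_indicator_Ioi_inv (by linarith)
  have hmem : ∀ i, MemLp (fun ω => g (X i ω)) 2 P := fun i =>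
    MemLp.of_bound (hgm.comp (hX i)).aestronglyMeasurable 2 (Filter.Eventually.of_forall fun ω => by
      rw [Real.norm_eq_abs, abs_of_nonneg (hg0 _)]; exact hg2 _)
  have e : ∀ ω, survSum (cdf μ) n T (fun j => X j ω) ^ 2 =
      (∑ i ∈ Finset.range n, (g (X i ω) - 1)) ^ 2 := by
    intro ω
    rw [survSum, ← neg_sq, ← Finset.sum_neg_distrib]
    simp [hg]
  simp_rw [e]
  rw [integral_sum_sub_sq_eq (Z := fun i ω => g (X i ω)) hmem
    (fun i j hij => (hind.indepFun hij).comp hgm hgm) hmean]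
  have hv : ∀ i ∈ Finset.range n, variance (fun ω => g (X i ω)) P ≤ 1 := by
    intro i _
    refine (variance_le_sub_mul_sub (a := 0) (b := 2)
      (Filter.Eventually.of_forall fun ω => ⟨hg0 _, hg2 _⟩)
      (hgm.comp (hX i)).aemeasurable).trans_eq ?_
    rw [hmean]
    norm_num
  refine (Finset.sum_le_card_nsmul _ _ _ hv).trans_eq ?_
  simp

/-- Kolmogorov's maximal inequality for the martingale `survSum`. -/
theorem measureReal_exists_le_survSum_le (hX : ∀ i, Measurable (X i)) (hind : iIndepFun X P)
    (hlaw : ∀ i, P.map (X i) = μ) (n : ℕ) {S : Finset ℝ} (hS : ∀ t ∈ S, cdf μ t ≤ 1 / 2)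
    {l : ℝ} (hl : 0 ≤ l) :
    l ^ 2 * P.real {ω | ∃ t ∈ S, l ≤ |survSum (cdf μ) n t (fun j => X j ω)|} ≤ n := by
  classical
  rcases S.eq_empty_or_nonempty with rfl | hne
  · simp
  set W : ℝ → (ℕ → ℝ) → ℝ := survSum (cdf μ) n with hW
  have hWm : ∀ t, Measurable (W t) := measurable_survSum _ n
  have hXv : Measurable fun ω => (fun j => X j ω) := measurable_pi_lambda _ hX
  set T := S.max' hne
  have hTS : T ∈ S := S.max'_mem hne
  have hT1 : cdf μ T < 1 := (hS T hTS).trans_lt (by norm_num)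
  -- `E t` is the event that level `l` is first reached at `t`; these events partition the crossing
  -- event.
  let E : ℝ → Set (ℕ → ℝ) := fun t => {x | l ≤ |W t x| ∧ ∀ s ∈ S, s < t → |W s x| < l}
  have hEm : ∀ t, MeasurableSet (E t) := by
    intro t
    have : E t = {x | l ≤ |W t x|} ∩ ⋂ s ∈ S, {x | s < t → |W s x| < l} := by
      ext x; simp [E]
    rw [this]
    refine (measurableSet_le measurable_const (hWm t).abs).inter
      (Finset.measurableSet_biInter _ fun s _ => ?_)
    by_cases hst : s < t
    · simpa [hst] using measurableSet_lt (hWm s).abs measurable_const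
    · simp [hst]
  have hdisj : (S : Set ℝ).PairwiseDisjoint fun t => (fun ω => (fun j => X j ω)) ⁻¹' E t := by
    intro s hs t ht hst
    refine Set.disjoint_left.2 fun ω h1 h2 => ?_
    rcases lt_or_gt_of_ne hst with h | h
    · exact absurd h1.1 (not_le.2 (h2.2 s hs h))
    · exact absurd h2.1 (not_le.2 (h1.2 t ht h))
  have hunion : {ω | ∃ t ∈ S, l ≤ |W t (fun j => X j ω)|} =
      ⋃ t ∈ S, (fun ω => (fun j => X j ω)) ⁻¹' E t := by
    ext ω
    simp only [mem_ofPred_eq, mem_iUnion, mem_preimage, exists_prop, E]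
    constructor
    · rintro ⟨t, ht, hlt⟩
      set S' := S.filter fun s => l ≤ |W s (fun j => X j ω)|
      have hne' : S'.Nonempty := ⟨t, by simp [S', ht, hlt]⟩
      have hmem := S'.min'_mem hne'
      refine ⟨S'.min' hne', (Finset.mem_filter.1 hmem).1, (Finset.mem_filter.1 hmem).2, ?_⟩
      intro s hs hlts
      by_contra hcon
      exact absurd (S'.min'_le s (Finset.mem_filter.2 ⟨hs, not_lt.1 hcon⟩)) (not_le.2 hlts)
    · rintro ⟨t, ht, hlt, -⟩
      exact ⟨t, ht, hlt⟩
  have hWint : Integrable (fun ω => W T (fun j => X j ω) ^ 2) P := by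
    refine Integrable.of_bound (C := (n * (1 + |(1 - cdf μ T)⁻¹|)) ^ 2)
      (((hWm T).comp hXv).pow_const 2).aestronglyMeasurable
      (Filter.Eventually.of_forall fun ω => ?_)
    rw [norm_pow, Real.norm_eq_abs]
    exact pow_le_pow_left₀ (abs_nonneg _) (abs_survSum_le _ _ _ _) 2
  have hpiece : ∀ t ∈ S, l ^ 2 * P.real ((fun ω => (fun j => X j ω)) ⁻¹' E t) ≤
      ∫ ω in (fun ω => (fun j => X j ω)) ⁻¹' E t, W T (fun j => X j ω) ^ 2 ∂P := by
    intro t ht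
    have htT : t ≤ T := S.le_max' t ht
    set φ : (ℕ → ℝ) → ℝ := fun x => (E t).indicator (W t) x with hφ
    have hφm : Measurable φ := (hWm t).indicator (hEm t)
    have hφK : ∀ x, |φ x| ≤ n * (1 + |(1 - cdf μ t)⁻¹|) := by
      intro x
      refine le_trans ?_ (abs_survSum_le (cdf μ) n t x)
      simp only [hφ, indicator]
      split_ifs
      · exact le_rfl
      · simp
    have hWeq : ∀ s ≤ t, ∀ x y : ℕ → ℝ, (∀ j < n, x j = y j ∨ (t < x j ∧ t < y j)) →
        W s x = W s y := by
      intro s hst x y hxy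
      simp only [hW, survSum]
      refine Finset.sum_congr rfl fun j hj => ?_
      congr 1
      rcases hxy j (Finset.mem_range.1 hj) with h | ⟨h1, h2⟩
      · rw [h]
      · rw [indicator_of_mem (show x j ∈ Ioi s from hst.trans_lt h1),
          indicator_of_mem (show y j ∈ Ioi s from hst.trans_lt h2)]
    have hloc : ∀ x y : ℕ → ℝ, (∀ j < n, x j = y j ∨ (t < x j ∧ t < y j)) → φ x = φ y := by
      intro x y hxy
      have hmem : x ∈ E t ↔ y ∈ E t := by
        simp only [E, mem_ofPred_eq, hWeq t le_rfl x y hxy]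
        refine and_congr_right fun _ => forall₂_congr fun s _ => forall_congr' fun hst => ?_
        rw [hWeq s hst.le x y hxy]
      by_cases hy : y ∈ E t
      · simp only [hφ, indicator_of_mem hy, indicator_of_mem (hmem.2 hy), hWeq t le_rfl x y hxy]
      · simp only [hφ, indicator_of_notMem hy, indicator_of_notMem (mt hmem.1 hy)]
    have horth := integral_mul_survSum_sub_eq_zero hX hind hlaw htT hT1 hφm hφK hloc
    have hφint : Integrable (fun ω => φ (fun j => X j ω) *
        (W T (fun j => X j ω) - W t (fun j => X j ω))) P := by
      refine Integrable.of_bound (C := (n * (1 + |(1 - cdf μ t)⁻¹|)) *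
        (n * (1 + |(1 - cdf μ T)⁻¹|) + n * (1 + |(1 - cdf μ t)⁻¹|)))
        ((hφm.comp hXv).mul (((hWm T).comp hXv).sub ((hWm t).comp hXv))).aestronglyMeasurable
        (Filter.Eventually.of_forall fun ω => ?_)
      rw [norm_mul, Real.norm_eq_abs, Real.norm_eq_abs]
      exact mul_le_mul (hφK _) ((abs_sub _ _).trans
        (add_le_add (abs_survSum_le _ _ _ _) (abs_survSum_le _ _ _ _)))
        (abs_nonneg _) (by positivity)
    have hmE : MeasurableSet ((fun ω => (fun j => X j ω)) ⁻¹' E t) := hXv (hEm t)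
    -- On `E t`, `W_T² ≥ W_t² + 2 W_t (W_T - W_t)` and `W_t² ≥ l²`; the cross term integrates to
    -- zero by `horth`.
    have hpt : ∀ ω, ((fun ω => (fun j => X j ω)) ⁻¹' E t).indicator (fun _ => l ^ 2) ω +
        2 * (φ (fun j => X j ω) * (W T (fun j => X j ω) - W t (fun j => X j ω))) ≤
        ((fun ω => (fun j => X j ω)) ⁻¹' E t).indicator
          (fun ω => W T (fun j => X j ω) ^ 2) ω := by
      intro ω
      by_cases hω : (fun j => X j ω) ∈ E t
      · rw [indicator_of_mem (show ω ∈ (fun ω => (fun j => X j ω)) ⁻¹' E t from hω),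
          indicator_of_mem (show ω ∈ (fun ω => (fun j => X j ω)) ⁻¹' E t from hω)]
        simp only [hφ, indicator_of_mem hω]
        have h1 : l ^ 2 ≤ W t (fun j => X j ω) ^ 2 := by
          rw [← sq_abs (W t _)]
          exact pow_le_pow_left₀ hl hω.1 2
        nlinarith [sq_nonneg (W T (fun j => X j ω) - W t (fun j => X j ω))]
      · rw [indicator_of_notMem (show ω ∉ (fun ω => (fun j => X j ω)) ⁻¹' E t from hω),
          indicator_of_notMem (show ω ∉ (fun ω => (fun j => X j ω)) ⁻¹' E t from hω)]
        simp [hφ, indicator_of_notMem hω]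
    have hi := integral_mono (((integrable_const (l ^ 2)).indicator hmE).add (hφint.const_mul 2))
      (hWint.indicator hmE) hpt
    simp only [Pi.add_apply] at hi
    rw [integral_add ((integrable_const (l ^ 2)).indicator hmE) (hφint.const_mul 2),
      integral_const_mul, horth, integral_indicator hmE, integral_indicator hmE] at hi
    simpa [mul_comm] using hi
  rw [hunion, measureReal_biUnion_finset hdisj fun t _ => hXv (hEm t), Finset.mul_sum]
  refine (Finset.sum_le_sum hpiece).trans ?_
  rw [← integral_biUnion_finset S (fun t _ => hXv (hEm t)) hdisj fun t _ => hWint.integrableOn]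
  refine (setIntegral_le_integral hWint (Filter.Eventually.of_forall fun ω => sq_nonneg _)).trans ?_
  exact integral_survSum_sq_le hX hind hlaw n (hS T hTS)

end FirstCrossing

/-! ### The Kolmogorov–Smirnov distance. -/

section KolmogorovSmirnov

theorem measure_singleton_eq_zero_of_continuous_cdf {μ : Measure ℝ} [IsProbabilityMeasure μ]
    (hF : Continuous (cdf μ)) (a : ℝ) : μ {a} = 0 := by
  rw [← measure_cdf μ, StieltjesFunction.measure_singleton,
    hF.continuousAt.continuousWithinAt.leftLim_eq, sub_self, ENNReal.ofReal_zero]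

theorem abs_empCDF_sub_le_one (n : ℕ) (x : ℕ → ℝ) (μ : Measure ℝ) (t : ℝ) :
    |empCDF n x t - cdf μ t| ≤ 1 := by
  have h0 : 0 ≤ empCDF n x t := mul_nonneg (by positivity)
    (Finset.sum_nonneg fun i _ => indicator_nonneg (fun _ _ => zero_le_one) _)
  have h1 : empCDF n x t ≤ 1 := by
    have : ∑ i ∈ Finset.range n, (Ici (x i)).indicator (fun _ => (1 : ℝ)) t ≤ n := by
      refine (Finset.sum_le_card_nsmul _ _ 1 fun i _ =>
        indicator_le_self' (fun _ _ => zero_le_one) _).trans_eq (by simp)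
    rw [empCDF]
    exact inv_mul_le_one_of_le₀ this n.cast_nonneg
  rw [abs_le]
  constructor <;> linarith [cdf_nonneg μ t, cdf_le_one μ t]

theorem measurable_empCDF (n : ℕ) (t : ℝ) : Measurable fun x : ℕ → ℝ => empCDF n x t := by
  refine measurable_const.mul (Finset.measurable_sum _ fun i _ => ?_)
  have : (fun x : ℕ → ℝ => (Ici (x i)).indicator (fun _ => (1 : ℝ)) t) =
      fun x => (Iic t).indicator (fun _ => (1 : ℝ)) (x i) := by
    ext x; simp [indicator]
  rw [this]
  exact (measurable_const.indicator measurableSet_Iic).comp (measurable_pi_apply i)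

/-- The Kolmogorov–Smirnov distance between the sample `x 0, …, x (n-1)` and `μ`, evaluated on the
rationals. -/
noncomputable def ksDist (μ : Measure ℝ) (n : ℕ) (x : ℕ → ℝ) : ℝ :=
  ⨆ q : ℚ, |empCDF n x q - cdf μ q|

theorem measurable_ksDist (μ : Measure ℝ) (n : ℕ) : Measurable (ksDist μ n) :=
  Measurable.iSup fun q => ((measurable_empCDF n q).sub_const _).abs

theorem le_ksDist (μ : Measure ℝ) (n : ℕ) (x : ℕ → ℝ) (q : ℚ) :
    |empCDF n x q - cdf μ q| ≤ ksDist μ n x :=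
  le_ciSup (f := fun q : ℚ => |empCDF n x q - cdf μ q|)
    ⟨1, by rintro _ ⟨q, rfl⟩; exact abs_empCDF_sub_le_one n x μ q⟩ q

theorem ksDist_nonneg (μ : Measure ℝ) (n : ℕ) (x : ℕ → ℝ) : 0 ≤ ksDist μ n x :=
  (abs_nonneg _).trans (le_ksDist μ n x 0)

/-- Recovers real levels, and left limits, from the rational ones: a closed bound passes to limits
along rationals. -/
theorem abs_le_ksDist_of_tendsto {μ : Measure ℝ} {n : ℕ} {x : ℕ → ℝ} {F : Filter ℝ} {d : ℝ}
    (hF : ∃ᶠ t in F, t ∈ range ((↑) : ℚ → ℝ))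
    (hd : Filter.Tendsto (fun t => empCDF n x t - cdf μ t) F (nhds d)) : |d| ≤ ksDist μ n x := by
  have := IsClosed.mem_of_frequently_of_tendsto (isClosed_Iic (a := ksDist μ n x))
    (hF.mono (by rintro _ ⟨q, rfl⟩; exact le_ksDist μ n x q)) hd.abs
  exact this

variable {Ω : Type*} [MeasurableSpace Ω] {P : Measure Ω} [IsProbabilityMeasure P]
  {μ : Measure ℝ} [IsProbabilityMeasure μ] {X : ℕ → Ω → ℝ}

theorem measure_exists_mem_finset_le_empCDF_sub (hX : ∀ i, Measurable (X i))
    (hind : iIndepFun X P) (hlaw : ∀ i, P.map (X i) = μ) {n : ℕ} (hn : n ≠ 0) {S : Finset ℝ}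
    (hS : ∀ t ∈ S, cdf μ t ≤ 1 / 2) {l : ℝ} (hl : 0 < l) :
    P {ω | ∃ t ∈ S, l ≤ |empCDF n (fun j => X j ω) t - cdf μ t|} ≤
      ENNReal.ofReal (1 / (n * l ^ 2)) := by
  have hn' : (0 : ℝ) < n := by positivity
  have h := measureReal_exists_le_survSum_le hX hind hlaw n hS (l := n * l) (by positivity)
  have hsub : {ω | ∃ t ∈ S, l ≤ |empCDF n (fun j => X j ω) t - cdf μ t|} ⊆
      {ω | ∃ t ∈ S, n * l ≤ |survSum (cdf μ) n t (fun j => X j ω)|} := by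
    rintro ω ⟨t, ht, hlt⟩
    refine ⟨t, ht, ?_⟩
    have h1 : cdf μ t < 1 := (hS t ht).trans_lt (by norm_num)
    rw [empCDF_sub_eq hn h1, abs_mul, abs_mul, abs_of_pos (sub_pos.2 h1),
      abs_of_pos (inv_pos.2 hn')] at hlt
    have h2 : l ≤ (n : ℝ)⁻¹ * |survSum (cdf μ) n t (fun j => X j ω)| := by
      refine hlt.trans (mul_le_of_le_one_left (by positivity) ?_)
      linarith [cdf_nonneg μ t]
    rwa [inv_mul_eq_div, le_div_iff₀ hn', mul_comm] at h2
  refine (measure_mono hsub).trans ?_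
  rw [← ofReal_measureReal]
  refine ENNReal.ofReal_le_ofReal ?_
  rw [le_div_iff₀ (by positivity)]
  have h3 : (n : ℝ) * (n * l ^ 2 * P.real {ω | ∃ t ∈ S, n * l ≤
      |survSum (cdf μ) n t (fun j => X j ω)|}) ≤ n * 1 := by
    linarith [h, mul_pow (n : ℝ) l 2]
  have := le_of_mul_le_mul_left h3 hn'
  linarith

/-- The maximal inequality does not depend on the size of the finite set of levels, so it passes to
the directed union over finite sets of rationals. -/
theorem measure_exists_rat_le_empCDF_sub_of_le_half (hX : ∀ i, Measurable (X i))
    (hind : iIndepFun X P) (hlaw : ∀ i, P.map (X i) = μ) {n : ℕ} (hn : n ≠ 0)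
    {l : ℝ} (hl : 0 < l) :
    P {ω | ∃ q : ℚ, cdf μ q ≤ 1 / 2 ∧ l ≤ |empCDF n (fun j => X j ω) q - cdf μ q|} ≤
      ENNReal.ofReal (1 / (n * l ^ 2)) := by
  classical
  let A : Finset ℚ → Set Ω := fun s =>
    {ω | ∃ q ∈ s, cdf μ q ≤ 1 / 2 ∧ l ≤ |empCDF n (fun j => X j ω) q - cdf μ q|}
  have hU : {ω | ∃ q : ℚ, cdf μ q ≤ 1 / 2 ∧ l ≤ |empCDF n (fun j => X j ω) q - cdf μ q|} =
      ⋃ s, A s := by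
    ext ω
    simp only [A, mem_ofPred_eq, mem_iUnion]
    exact ⟨fun ⟨q, hq⟩ => ⟨{q}, q, Finset.mem_singleton_self q, hq⟩,
      fun ⟨_, q, _, hq⟩ => ⟨q, hq⟩⟩
  have hmono : Monotone A := fun s t hst ω ⟨q, hq, h⟩ => ⟨q, hst hq, h⟩
  rw [hU, hmono.directed_le.measure_iUnion]
  refine iSup_le fun s => ?_
  refine le_trans (measure_mono ?_) (measure_exists_mem_finset_le_empCDF_sub hX hind hlaw hn
    (S := (s.image ((↑) : ℚ → ℝ)).filter fun t => cdf μ t ≤ 1 / 2)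
    (fun t ht => (Finset.mem_filter.1 ht).2) hl)
  rintro ω ⟨q, hq, h1, h2⟩
  exact ⟨q, Finset.mem_filter.2 ⟨Finset.mem_image_of_mem _ hq, h1⟩, h2⟩

/-- Levels with `F q > 1/2` become levels below `1/2` for the sample `-X`. Without atoms, almost
surely no observation is rational, so the reflection is exact; the two halves give the factor `2`.
-/
theorem measure_exists_rat_le_empCDF_sub (hF : Continuous (cdf μ)) (hX : ∀ i, Measurable (X i))
    (hind : iIndepFun X P) (hlaw : ∀ i, P.map (X i) = μ) {n : ℕ} (hn : n ≠ 0)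
    {l : ℝ} (hl : 0 < l) :
    P {ω | ∃ q : ℚ, l ≤ |empCDF n (fun j => X j ω) q - cdf μ q|} ≤
      ENNReal.ofReal (2 / (n * l ^ 2)) := by
  have hatom := measure_singleton_eq_zero_of_continuous_cdf hF
  set μ' := μ.map fun x => -x with hμ'
  have : IsProbabilityMeasure μ' := Measure.isProbabilityMeasure_map (by fun_prop)
  have h1 := measure_exists_rat_le_empCDF_sub_of_le_half hX hind hlaw hn hl
  have h2 := measure_exists_rat_le_empCDF_sub_of_le_half (X := fun i ω => -X i ω) (μ := μ') (P := P)
    (fun i => (hX i).neg) (hind.comp (fun _ x => -x) fun _ => measurable_neg)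
    (fun i => by rw [hμ', ← hlaw i, Measure.map_map measurable_neg (hX i)]; rfl) hn hl
  have hcdf : ∀ q : ℝ, cdf μ' (-q) = 1 - cdf μ q := by
    intro q
    have hpre : (fun x : ℝ => -x) ⁻¹' Iic (-q) = Ici q := by ext; simp
    rw [cdf_eq_real, cdf_eq_real, hμ', map_measureReal_apply measurable_neg measurableSet_Iic,
      hpre, ← compl_Iio, probReal_compl_eq_one_sub measurableSet_Iio, measureReal_def,
      measureReal_def, measure_congr (Iio_ae_eq_Iic' (hatom q))]
  have hne : ∀ᵐ ω ∂P, ∀ (q : ℚ) (i : ℕ), X i ω ≠ q := by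
    refine ae_all_iff.2 fun q => ae_all_iff.2 fun i => ?_
    have : ∀ᵐ x ∂(P.map (X i)), x ≠ (q : ℝ) := by
      rw [hlaw i, ae_iff]
      simpa using hatom q
    exact ae_of_ae_map (hX i).aemeasurable this
  have hemp : ∀ᵐ ω ∂P, ∀ q : ℚ,
      empCDF n (fun j => -X j ω) (-q) = 1 - empCDF n (fun j => X j ω) q := by
    filter_upwards [hne] with ω hω q
    have : ∀ i, (Ici (-X i ω)).indicator (fun _ => (1 : ℝ)) (-(q : ℝ)) =
        1 - (Ici (X i ω)).indicator (fun _ => (1 : ℝ)) (q : ℝ) := by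
      intro i
      have := hω q i
      simp only [indicator, mem_Ici, neg_le_neg_iff]
      rcases lt_or_gt_of_ne this with h | h
      · simp [h, h.le]
      · simp [h.le, not_le.2 h]
    have hn' : (n : ℝ) ≠ 0 := by exact_mod_cast hn
    simp only [empCDF, this]
    rw [Finset.sum_sub_distrib, mul_sub]
    simp [hn']
  have hsub : {ω | ∃ q : ℚ, l ≤ |empCDF n (fun j => X j ω) q - cdf μ q|} ≤ᵐ[P]
      ({ω | ∃ q : ℚ, cdf μ q ≤ 1 / 2 ∧ l ≤ |empCDF n (fun j => X j ω) q - cdf μ q|} ∪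
      {ω | ∃ q : ℚ, cdf μ' q ≤ 1 / 2 ∧ l ≤ |empCDF n (fun j => -X j ω) q - cdf μ' q|} : Set Ω) := by
    filter_upwards [hemp] with ω hω hmem
    obtain ⟨q, hq⟩ := hmem
    rcases le_or_gt (cdf μ q) (1 / 2) with h | h
    · exact Or.inl ⟨q, h, hq⟩
    · refine Or.inr ⟨-q, ?_, ?_⟩
      · push_cast
        rw [hcdf]
        linarith
      · push_cast
        rw [hω q, hcdf, ← abs_neg]
        convert hq using 2
        ring
  refine (measure_mono_ae hsub).trans ((measure_union_le _ _).trans ((add_le_add h1 h2).trans_eq ?_))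
  rw [← ENNReal.ofReal_add (by positivity) (by positivity)]
  congr 1
  ring

theorem isBigOInProb_ksDist_sq (hF : Continuous (cdf μ)) (hX : ∀ i, Measurable (X i))
    (hind : iIndepFun X P) (hlaw : ∀ i, P.map (X i) = μ) :
    IsBigOInProb P (fun n ω => ksDist μ n (fun j => X j ω) ^ 2) (fun n => 1 / (n : ℝ)) := by
  intro ε hε
  -- With `l² = (2 / ε) / n` the tail bound `2 / (n l²)` equals `ε`.
  refine ⟨2 / ε, by positivity, 1, fun n hn => ?_⟩
  have hn' : (0 : ℝ) < n := by exact_mod_cast hn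
  set l := Real.sqrt (2 / ε * (1 / n))
  have hl : 0 < l := Real.sqrt_pos.2 (by positivity)
  have hl2 : l ^ 2 = 2 / ε * (1 / n) := Real.sq_sqrt (by positivity)
  refine (measure_mono ?_).trans ((measure_exists_rat_le_empCDF_sub hF hX hind hlaw
    (by omega : n ≠ 0) hl).trans_eq ?_)
  · intro ω hω
    have h1 : 2 / ε * (1 / (n : ℝ)) < ksDist μ n (fun j => X j ω) ^ 2 := by
      have h0 : 2 / ε * (1 / (n : ℝ)) < |ksDist μ n (fun j => X j ω) ^ 2| := hω
      rwa [abs_of_nonneg (by positivity)] at h0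
    rw [← hl2] at h1
    have h2 : l < ksDist μ n (fun j => X j ω) :=
      lt_of_pow_lt_pow_left₀ 2 (ksDist_nonneg _ _ _) h1
    obtain ⟨q, hq⟩ := exists_lt_of_lt_ciSup h2
    exact ⟨q, hq.le⟩
  · congr 1
    rw [hl2]
    field_simp

theorem frequently_nhdsGT_range_ratCast (a : ℝ) :
    ∃ᶠ t in nhdsWithin a (Ioi a), t ∈ range ((↑) : ℚ → ℝ) := by
  rw [Filter.frequently_iff]
  intro U hU
  obtain ⟨u, hu, hsub⟩ := (mem_nhdsGT_iff_exists_Ioo_subset).1 hU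
  obtain ⟨q, h1, h2⟩ := exists_rat_btwn (show a < u from hu)
  exact ⟨q, hsub ⟨h1, h2⟩, q, rfl⟩

theorem frequently_nhdsLT_range_ratCast (a : ℝ) :
    ∃ᶠ t in nhdsWithin a (Iio a), t ∈ range ((↑) : ℚ → ℝ) := by
  rw [Filter.frequently_iff]
  intro U hU
  obtain ⟨u, hu, hsub⟩ := (mem_nhdsLT_iff_exists_Ioo_subset).1 hU
  obtain ⟨q, h1, h2⟩ := exists_rat_btwn (show u < a from hu)
  exact ⟨q, hsub ⟨h1, h2⟩, q, rfl⟩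

theorem abs_empirical_Iic_sub_le_ksDist (hF : Continuous (cdf μ)) (n : ℕ) (x : ℕ → ℝ) (a : ℝ) :
    |(n : ℝ)⁻¹ * ∑ i ∈ Finset.range n, (Iic a).indicator (fun _ => (1 : ℝ)) (x i) - μ.real (Iic a)|
      ≤ ksDist μ n x := by
  refine abs_le_ksDist_of_tendsto (frequently_nhdsGT_range_ratCast a) ?_
  rw [← cdf_eq_real]
  refine Filter.Tendsto.sub (tendsto_const_nhds.mul (tendsto_finsetSum _ fun i _ => ?_))
    (hF.continuousAt.mono_left nhdsWithin_le_nhds)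
  refine tendsto_const_nhds.congr' ?_
  rcases le_or_gt (x i) a with h | h
  · filter_upwards [self_mem_nhdsWithin] with t ht
    simp [h, h.trans (le_of_lt (show a < t from ht))]
  · filter_upwards [nhdsWithin_le_nhds (Iio_mem_nhds h)] with t ht
    simp [h, show t < x i from ht]

theorem abs_empirical_Iio_sub_le_ksDist (hF : Continuous (cdf μ)) (n : ℕ) (x : ℕ → ℝ) (a : ℝ) :
    |(n : ℝ)⁻¹ * ∑ i ∈ Finset.range n, (Iio a).indicator (fun _ => (1 : ℝ)) (x i) - μ.real (Iio a)|
      ≤ ksDist μ n x := by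
  refine abs_le_ksDist_of_tendsto (frequently_nhdsLT_range_ratCast a) ?_
  have : μ.real (Iio a) = cdf μ a := by
    rw [cdf_eq_real, measureReal_def, measureReal_def, measure_congr
      (Iio_ae_eq_Iic' (measure_singleton_eq_zero_of_continuous_cdf hF a))]
  rw [this]
  refine Filter.Tendsto.sub (tendsto_const_nhds.mul (tendsto_finsetSum _ fun i _ => ?_))
    (hF.continuousAt.mono_left nhdsWithin_le_nhds)
  refine tendsto_const_nhds.congr' ?_
  rcases lt_or_ge (x i) a with h | h
  · filter_upwards [nhdsWithin_le_nhds (Ioi_mem_nhds h)] with t ht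
    simp [h, le_of_lt (show x i < t from ht)]
  · filter_upwards [self_mem_nhdsWithin] with t ht
    simp [h, (show t < a from ht).trans_le h]

/-- A lower set of `ℝ` is empty, an open or closed half-line, or everything, so one random variable
controls them all. -/
theorem abs_empirical_sub_le_ksDist_of_isLowerSet (hF : Continuous (cdf μ)) {n : ℕ} (hn : n ≠ 0)
    (x : ℕ → ℝ) {s : Set ℝ} (hs : IsLowerSet s) :
    |(n : ℝ)⁻¹ * ∑ i ∈ Finset.range n, s.indicator (fun _ => (1 : ℝ)) (x i) - μ.real s|
      ≤ ksDist μ n x := by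
  have hn' : (n : ℝ) ≠ 0 := by exact_mod_cast hn
  rcases s.eq_empty_or_nonempty with rfl | hne
  · simpa using ksDist_nonneg μ n x
  by_cases hb : BddAbove s
  · have hsub : Iio (sSup s) ⊆ s := fun y hy => by
      obtain ⟨z, hz, hyz⟩ := exists_lt_of_lt_csSup hne hy
      exact hs hyz.le hz
    have hsup : s ⊆ Iic (sSup s) := fun y hy => le_csSup hb hy
    by_cases hmem : sSup s ∈ s
    · have : s = Iic (sSup s) := Subset.antisymm hsup fun y hy => hs hy hmem
      rw [this]
      exact abs_empirical_Iic_sub_le_ksDist hF n x _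
    · have : s = Iio (sSup s) := Subset.antisymm
        (fun y hy => lt_of_le_of_ne (hsup hy) fun h : y = sSup s => hmem (h ▸ hy)) hsub
      rw [this]
      exact abs_empirical_Iio_sub_le_ksDist hF n x _
  · have : s = univ := by
      refine eq_univ_of_forall fun y => ?_
      obtain ⟨z, hz, hyz⟩ := not_bddAbove_iff.1 hb y
      exact hs hyz.le hz
    subst this
    simpa [hn'] using ksDist_nonneg μ n x

end KolmogorovSmirnov

/-! ### Empirical measures, convolution and `L²` distances. -/

section EmpiricalMeasure

/-- The empirical measure of `y 0, …, y (n-1)`. -/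
noncomputable def empMeasure (n : ℕ) (y : ℕ → ℝ) : Measure ℝ :=
  (n : ENNReal)⁻¹ • ∑ i ∈ Finset.range n, Measure.dirac (y i)

theorem isProbabilityMeasure_empMeasure {n : ℕ} (hn : n ≠ 0) (y : ℕ → ℝ) :
    IsProbabilityMeasure (empMeasure n y) := by
  refine ⟨?_⟩
  simp only [empMeasure, Measure.smul_apply, Measure.finsetSum_apply, measure_univ, smul_eq_mul,
    Finset.sum_const, Finset.card_range, nsmul_eq_mul, mul_one]
  exact ENNReal.inv_mul_cancel (by exact_mod_cast hn) (ENNReal.natCast_ne_top n)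

theorem integrable_empMeasure {n : ℕ} (hn : n ≠ 0) (y : ℕ → ℝ) (g : ℝ → ℝ) :
    Integrable g (empMeasure n y) := by
  refine Integrable.smul_measure ?_ (ENNReal.inv_ne_top.2 (by exact_mod_cast hn))
  exact integrable_finsetSum_measure.2 fun i _ => integrable_dirac (by simp)

theorem integral_empMeasure (n : ℕ) (y : ℕ → ℝ) (g : ℝ → ℝ) :
    ∫ a, g a ∂(empMeasure n y) = (n : ℝ)⁻¹ * ∑ i ∈ Finset.range n, g (y i) := by
  rw [empMeasure, integral_smul_measure, integral_finsetSum_measure fun i _ => integrable_dirac (by simp)]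
  simp

theorem cdf_empMeasure {n : ℕ} (hn : n ≠ 0) (y : ℕ → ℝ) (t : ℝ) :
    cdf (empMeasure n y) t = empCDF n y t := by
  have := isProbabilityMeasure_empMeasure hn y
  rw [cdf_eq_integral_stepAt, integral_empMeasure, empCDF]

theorem cdf_conv (p ν : Measure ℝ) [IsProbabilityMeasure p] [IsProbabilityMeasure ν] (t : ℝ) :
    cdf (p ∗ ν) t = ∫ a, cdf ν (t - a) ∂p := by
  have h : ∀ a, cdf ν (t - a) = ∫ b, stepAt (a + b) t ∂ν := by
    intro a
    rw [cdf_eq_integral_stepAt]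
    congr 1; ext b
    simp only [stepAt, indicator, mem_Ici, le_sub_iff_add_le, add_comm b a]
  have hm : Measurable fun a => stepAt a t := by
    simp_rw [stepAt_eq_indicator_Iic]
    exact measurable_const.indicator measurableSet_Iic
  simp_rw [h]
  rw [cdf_eq_integral_stepAt, Measure.conv, integral_map (by fun_prop) hm.aestronglyMeasurable,
    integral_prod]
  refine Integrable.of_bound (C := 1) (hm.comp (by fun_prop)).aestronglyMeasurable
    (Filter.Eventually.of_forall fun z => ?_)
  simp only [stepAt, indicator]
  split_ifs <;> simp

theorem integral_cdf_sub_sq_triangle {p q r : Measure ℝ} [IsProbabilityMeasure p]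
    [IsProbabilityMeasure q] [IsProbabilityMeasure r] (hp : Integrable (fun x : ℝ => x) p)
    (hq : Integrable (fun x : ℝ => x) q) (hr : Integrable (fun x : ℝ => x) r) :
    ∫ t, (cdf p t - cdf r t) ^ 2 ≤
      2 * (∫ t, (cdf p t - cdf q t) ^ 2) + 2 * ∫ t, (cdf q t - cdf r t) ^ 2 := by
  have h1 := (memLp_two_cdf_sub_cdf hp hq).integrable_sq.const_mul 2
  have h2 := (memLp_two_cdf_sub_cdf hq hr).integrable_sq.const_mul 2
  rw [← integral_const_mul, ← integral_const_mul, ← integral_add h1 h2]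
  refine integral_mono (memLp_two_cdf_sub_cdf hp hr).integrable_sq (h1.add h2) fun t => ?_
  dsimp only
  nlinarith [sq_nonneg (cdf p t - cdf q t - (cdf q t - cdf r t))]

/-- Dominated by `|cdf p - stepAt 0|`: use the factor `1 - cdf p` to the right of `0` and `cdf p` to
the left. -/
theorem integrable_cdf_mul_one_sub {p : Measure ℝ} [IsProbabilityMeasure p]
    (hp : Integrable (fun x : ℝ => x) p) : Integrable fun t => cdf p t * (1 - cdf p t) := by
  have hm : Measurable (cdf p) := (monotone_cdf p).measurable
  refine (integrable_cdf_sub_stepAt_zero hp).norm.mono'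
    (hm.mul (measurable_const.sub hm)).aestronglyMeasurable
    (Filter.Eventually.of_forall fun t => ?_)
  have h0 := cdf_nonneg p t
  have h1 := cdf_le_one p t
  rw [Real.norm_eq_abs, Real.norm_eq_abs, abs_of_nonneg (mul_nonneg h0 (sub_nonneg.2 h1))]
  simp only [stepAt, indicator]
  split_ifs
  · rw [abs_sub_comm, abs_of_nonneg (sub_nonneg.2 h1)]
    exact mul_le_of_le_one_left (sub_nonneg.2 h1) h1
  · rw [sub_zero, abs_of_nonneg h0]
    exact mul_le_of_le_one_right h0 (by linarith)

end EmpiricalMeasure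

/-! ### Integrated variances are `O_p(1/n)`. -/

section IntegratedVariance

variable {Ω : Type*} [MeasurableSpace Ω] {P : Measure Ω}

theorem isBigOInProb_integral_of_lintegral_le {D : ℕ → Ω → ℝ → ℝ}
    (hDm : ∀ n, Measurable (Function.uncurry (D n))) (hD0 : ∀ n ω t, 0 ≤ D n ω t) {I : ℝ}
    (hI : 0 ≤ I) (h : ∀ n : ℕ, 1 ≤ n → ∫⁻ ω, (∫⁻ t, ENNReal.ofReal (D n ω t)) ∂P ≤
      ENNReal.ofReal ((n : ℝ)⁻¹ * I)) :
    IsBigOInProb P (fun n ω => ∫ t, D n ω t) (fun n => 1 / (n : ℝ)) := by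
  intro ε hε
  have hC : 0 < I / ε + 1 := by positivity
  -- Markov's inequality; the `+ 1` keeps the constant positive when `I = 0`.
  refine ⟨I / ε + 1, hC, 1, fun n hn => ?_⟩
  have hn' : (0 : ℝ) < n := by exact_mod_cast hn
  have hpos : 0 < (I / ε + 1) * (1 / (n : ℝ)) := by positivity
  have hm : Measurable fun ω => ∫⁻ t, ENNReal.ofReal (D n ω t) :=
    (hDm n).ennreal_ofReal.lintegral_prod_right'
  have hsub : {ω | (I / ε + 1) * (1 / (n : ℝ)) < |∫ t, D n ω t|} ⊆
      {ω | ENNReal.ofReal ((I / ε + 1) * (1 / (n : ℝ))) ≤ ∫⁻ t, ENNReal.ofReal (D n ω t)} := by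
    intro ω hω
    have h0 : (I / ε + 1) * (1 / (n : ℝ)) < |∫ t, D n ω t| := hω
    have hDω : Measurable (D n ω) := (hDm n).comp (measurable_const.prodMk measurable_id)
    rw [abs_of_nonneg (integral_nonneg (hD0 n ω)), integral_eq_lintegral_of_nonneg_ae
      (Filter.Eventually.of_forall (hD0 n ω)) hDω.aestronglyMeasurable] at h0
    exact ENNReal.ofReal_le_of_le_toReal h0.le
  refine (measure_mono hsub).trans ?_
  refine (meas_ge_le_lintegral_div hm.aemeasurable (ENNReal.ofReal_pos.2 hpos).ne'
    ENNReal.ofReal_ne_top).trans ?_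
  refine (ENNReal.div_le_div_right (h n hn) _).trans ?_
  rw [← ENNReal.ofReal_div_of_pos hpos]
  refine ENNReal.ofReal_le_ofReal ?_
  rw [div_le_iff₀ hpos]
  field_simp
  linarith

variable [IsProbabilityMeasure P]

/-- Tonelli reduces to fixed `t`, where a `[0,1]`-valued variable of mean `H` has variance at most
`H (1 - H)`. This covers both indicators of the responses and smoothed terms `cdf ν (t - m (X i))`.
-/
theorem lintegral_lintegral_sq_mean_sub_le {G : ℕ → Ω → ℝ → ℝ} {H : ℝ → ℝ}
    (hG : ∀ i, Measurable (Function.uncurry (G i))) (hG01 : ∀ i ω t, G i ω t ∈ Icc (0 : ℝ) 1)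
    (hind : ∀ t, Pairwise fun i j => IndepFun (fun ω => G i ω t) (fun ω => G j ω t) P)
    (hmean : ∀ i t, ∫ ω, G i ω t ∂P = H t) (hHm : Measurable H)
    (hH0 : ∀ t, 0 ≤ H t * (1 - H t)) (hH : Integrable fun t => H t * (1 - H t))
    {n : ℕ} (hn : 1 ≤ n) :
    ∫⁻ ω, (∫⁻ t, ENNReal.ofReal (((n : ℝ)⁻¹ * ∑ i ∈ Finset.range n, G i ω t - H t) ^ 2)) ∂P ≤
      ENNReal.ofReal ((n : ℝ)⁻¹ * ∫ t, H t * (1 - H t)) := by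
  have hn' : (0 : ℝ) < n := by exact_mod_cast hn
  set D : Ω → ℝ → ℝ := fun ω t => ((n : ℝ)⁻¹ * ∑ i ∈ Finset.range n, G i ω t - H t) ^ 2 with hD
  have hDm : Measurable (Function.uncurry D) :=
    ((measurable_const.mul (Finset.measurable_sum _ fun i _ => hG i)).sub
      (hHm.comp measurable_snd)).pow_const 2
  have hGt : ∀ i t, Measurable fun ω => G i ω t := fun i t =>
    (hG i).comp (measurable_id.prodMk measurable_const)
  have hmem : ∀ i t, MemLp (fun ω => G i ω t) 2 P := fun i t =>
    MemLp.of_bound (hGt i t).aestronglyMeasurable 1 (Filter.Eventually.of_forall fun ω => by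
      rw [Real.norm_eq_abs, abs_of_nonneg (hG01 i ω t).1]; exact (hG01 i ω t).2)
  have hDt : ∀ t, ∫⁻ ω, ENNReal.ofReal (D ω t) ∂P ≤
      ENNReal.ofReal ((n : ℝ)⁻¹ * (H t * (1 - H t))) := by
    intro t
    have e : ∀ ω, D ω t = ((n : ℝ)⁻¹) ^ 2 * (∑ i ∈ Finset.range n, (G i ω t - H t)) ^ 2 := by
      intro ω
      rw [hD, ← mul_pow, Finset.sum_sub_distrib, mul_sub]
      simp [hn'.ne']
    have hint : Integrable (fun ω => D ω t) P := by
      simp_rw [e]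
      exact ((memLp_finsetSum _ fun i _ =>
        ((hmem i t).sub (memLp_const (H t)))).integrable_sq).const_mul _
    rw [← ofReal_integral_eq_lintegral_ofReal hint
      (Filter.Eventually.of_forall fun ω => sq_nonneg _)]
    refine ENNReal.ofReal_le_ofReal ?_
    simp_rw [e]
    rw [integral_const_mul, integral_sum_sub_sq_eq (Z := fun i ω => G i ω t) (fun i => hmem i t)
      (hind t) (fun i => hmean i t)]
    have hv : ∀ i ∈ Finset.range n, variance (fun ω => G i ω t) P ≤ H t * (1 - H t) := by
      intro i _
      refine (variance_le_sub_mul_sub (a := 0) (b := 1)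
        (Filter.Eventually.of_forall fun ω => hG01 i ω t) (hGt i t).aemeasurable).trans_eq ?_
      rw [hmean]
      ring
    refine (mul_le_mul_of_nonneg_left (Finset.sum_le_card_nsmul _ _ _ hv) (by positivity)).trans_eq ?_
    rw [Finset.card_range, nsmul_eq_mul]
    field_simp
  rw [lintegral_lintegral_swap hDm.ennreal_ofReal.aemeasurable]
  refine (lintegral_mono hDt).trans_eq ?_
  rw [← integral_const_mul, ofReal_integral_eq_lintegral_ofReal (hH.const_mul _)
    (Filter.Eventually.of_forall fun t => mul_nonneg (by positivity) (hH0 t))]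

theorem isBigOInProb_integral_sq_mean_sub {G : ℕ → Ω → ℝ → ℝ} {H : ℝ → ℝ}
    (hG : ∀ i, Measurable (Function.uncurry (G i))) (hG01 : ∀ i ω t, G i ω t ∈ Icc (0 : ℝ) 1)
    (hind : ∀ t, Pairwise fun i j => IndepFun (fun ω => G i ω t) (fun ω => G j ω t) P)
    (hmean : ∀ i t, ∫ ω, G i ω t ∂P = H t) (hHm : Measurable H)
    (hH0 : ∀ t, 0 ≤ H t * (1 - H t)) (hH : Integrable fun t => H t * (1 - H t)) :
    IsBigOInProb P (fun n ω => ∫ t, ((n : ℝ)⁻¹ * ∑ i ∈ Finset.range n, G i ω t - H t) ^ 2)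
      (fun n => 1 / (n : ℝ)) :=
  isBigOInProb_integral_of_lintegral_le
    (D := fun n ω t => ((n : ℝ)⁻¹ * ∑ i ∈ Finset.range n, G i ω t - H t) ^ 2)
    (fun _ => ((measurable_const.mul (Finset.measurable_sum _ fun i _ => hG i)).sub
      (hHm.comp measurable_snd)).pow_const 2)
    (fun _ _ _ => sq_nonneg _) (integral_nonneg hH0)
    fun _ hn => lintegral_lintegral_sq_mean_sub_le hG hG01 hind hmean hHm hH0 hH hn

end IntegratedVariance

/-! ### Monotone regression functions and the minimum contrast property. -/

section MonotoneRegression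

theorem exists_monotone_eqOn_Icc {m : ℝ → ℝ} (hm : MonotoneOn m (Icc 0 1)) :
    ∃ m' : ℝ → ℝ, Monotone m' ∧ EqOn m m' (Icc 0 1) := by
  refine ⟨IccExtend zero_le_one ((Icc (0 : ℝ) 1).domRestrict m), ?_, fun x hx => ?_⟩
  · exact Monotone.IccExtend _ fun a b hab => hm a.2 b.2 hab
  · rw [IccExtend_of_mem _ _ hx, domRestrict_apply]

variable {μ : Measure ℝ}

theorem popL_congr_ae {m m' : ℝ → ℝ} (h : ∀ᵐ x ∂μ, m x = m' x) (w : ℝ) :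
    popL μ m w = popL μ m' w := by
  refine integral_congr_ae ?_
  filter_upwards [h] with x hx
  simp [indicator, hx]

theorem empL_congr {n : ℕ} {x : ℕ → ℝ} {m m' : ℝ → ℝ} (h : ∀ i, m (x i) = m' (x i)) (w : ℝ) :
    empL n x m w = empL n x m' w := by
  simp [empL, indicator, h]

theorem empL_eq_empCDF (n : ℕ) (x : ℕ → ℝ) (m : ℝ → ℝ) (w : ℝ) :
    empL n x m w = empCDF n (fun i => m (x i)) w := by
  simp [empL, empCDF, indicator]

theorem popL_eq_measureReal {m : ℝ → ℝ} (hm : Measurable m) (w : ℝ) :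
    popL μ m w = μ.real {t | m t ≤ w} := by
  rw [popL, integral_indicator (measurableSet_le hm measurable_const)]
  simp

variable [IsProbabilityMeasure μ]

theorem popL_eq_cdf {m : ℝ → ℝ} (hm : Measurable m) (w : ℝ) :
    popL μ m w = cdf (μ.map m) w := by
  have : IsProbabilityMeasure (μ.map m) := Measure.isProbabilityMeasure_map hm.aemeasurable
  rw [popL_eq_measureReal hm, cdf_eq_real, map_measureReal_apply hm measurableSet_Iic]
  rfl

/-- After a monotone extension off `[0,1]`, the sublevel sets of `m` are lower sets. The bound does
not involve `m`, so `m` may depend on the sample. -/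
theorem abs_empL_sub_popL_le_ksDist (hF : Continuous (cdf μ)) (hμ : ∀ᵐ x ∂μ, x ∈ Icc (0 : ℝ) 1)
    {n : ℕ} (hn : n ≠ 0) {x : ℕ → ℝ} (hx : ∀ i, x i ∈ Icc (0 : ℝ) 1) {m : ℝ → ℝ}
    (hm : MonotoneOn m (Icc 0 1)) (w : ℝ) :
    |empL n x m w - popL μ m w| ≤ ksDist μ n x := by
  obtain ⟨m', hm', heq⟩ := exists_monotone_eqOn_Icc hm
  rw [empL_congr (fun i => heq (hx i)), popL_congr_ae (hμ.mono fun x hx => heq hx),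
    popL_eq_measureReal hm'.measurable]
  exact abs_empirical_sub_le_ksDist_of_isLowerSet hF hn x
    (s := {t | m' t ≤ w}) fun a b hab ha => (hm' hab).trans ha

theorem intervalIntegral_empL_sub_popL_sq_le (hF : Continuous (cdf μ))
    (hμ : ∀ᵐ x ∂μ, x ∈ Icc (0 : ℝ) 1) {n : ℕ} (hn : n ≠ 0) {x : ℕ → ℝ}
    (hx : ∀ i, x i ∈ Icc (0 : ℝ) 1) {m : ℝ → ℝ} (hm : MonotoneOn m (Icc 0 1)) {a b : ℝ}
    (hab : a ≤ b) :
    ∫ w in a..b, (empL n x m w - popL μ m w) ^ 2 ≤ (b - a) * ksDist μ n x ^ 2 := by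
  have h := intervalIntegral.norm_integral_le_of_norm_le_const (a := a) (b := b)
    (f := fun w => (empL n x m w - popL μ m w) ^ 2) (C := ksDist μ n x ^ 2) fun w _ => by
      rw [norm_pow, Real.norm_eq_abs]
      exact pow_le_pow_left₀ (abs_nonneg _) (abs_empL_sub_popL_le_ksDist hF hμ hn hx hm w) 2
  rw [abs_of_nonneg (sub_nonneg.2 hab), mul_comm] at h
  exact (le_abs_self _).trans h

/-- A monotone function on `[0,1]` has a monotone right-continuous version that differs from it on
a countable set only. -/
theorem exists_monotone_rightCts_ae_eq (hF : Continuous (cdf μ))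
    (hμ : ∀ᵐ x ∂μ, x ∈ Icc (0 : ℝ) 1) {m : ℝ → ℝ} (hm : MonotoneOn m (Icc 0 1)) :
    ∃ m' : ℝ → ℝ, Monotone m' ∧ m' ∈ monoClass ∧ ∀ᵐ x ∂μ, m x = m' x := by
  obtain ⟨m₁, hm₁, heq⟩ := exists_monotone_eqOn_Icc hm
  have hmono : Monotone hm₁.stieltjesFunction := hm₁.stieltjesFunction.mono
  refine ⟨hm₁.stieltjesFunction, hmono, ⟨hmono.monotoneOn _,
    ⟨max |hm₁.stieltjesFunction 0| |hm₁.stieltjesFunction 1|, fun x hx =>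
      abs_le_max_abs_abs (hmono hx.1) (hmono hx.2)⟩, fun x _ =>
      (hm₁.stieltjesFunction.right_continuous x).mono Icc_subset_Ici_self⟩, ?_⟩
  -- A monotone function has countably many discontinuities, a null set since `μ` has no atoms;
  -- elsewhere the right limit is the value.
  have hcount : ∀ᵐ x ∂μ, ContinuousAt m₁ x := by
    have : NullSingletonClass μ := ⟨measure_singleton_eq_zero_of_continuous_cdf hF⟩
    exact hm₁.countable_not_continuousAt.measure_zero μ
  filter_upwards [hμ, hcount] with x hx hc
  rw [heq hx, hm₁.stieltjesFunction_eq]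
  exact (hc.continuousWithinAt.rightLim_eq).symm

theorem integrable_id_map_of_monoClass (hμ : ∀ᵐ x ∂μ, x ∈ Icc (0 : ℝ) 1) {m : ℝ → ℝ}
    (hm : Monotone m) (hmc : m ∈ monoClass) : Integrable (fun x : ℝ => x) (μ.map m) := by
  obtain ⟨K, hK⟩ := hmc.2.1
  rw [integrable_map_measure (by fun_prop) hm.measurable.aemeasurable]
  exact Integrable.of_bound hm.measurable.aestronglyMeasurable K (hμ.mono fun x hx => hK x hx)

theorem charFun_eq_phi {f : ℝ → ℝ} {ν : Measure ℝ} (hf : IsDensityOf f ν) (t : ℝ) :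
    charFun ν t = phi f t := by
  obtain ⟨hfm, hf0, hν⟩ := hf
  rw [charFun_apply_real, hν, integral_withDensity_eq_integral_toReal_smul
    hfm.ennreal_ofReal (Filter.Eventually.of_forall fun x => ENNReal.ofReal_lt_top), phi]
  congr 1; ext x
  rw [ENNReal.toReal_ofReal (hf0 x), Complex.real_smul, mul_comm]
  congr 2
  ring

theorem contrast_eq_integral_cdf_sub {ν : Measure ℝ} [IsProbabilityMeasure ν] {n : ℕ} (hn : n ≠ 0)
    (x y : ℕ → ℝ) (m : ℝ → ℝ) :
    contrast ν n x y m = ∫ t, (cdf (empMeasure n y) t -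
      cdf (empMeasure n (fun i => m (x i)) ∗ ν) t) ^ 2 := by
  have := isProbabilityMeasure_empMeasure hn (fun i => m (x i))
  rw [contrast]
  congr 1; ext t
  rw [cdf_empMeasure hn, cdf_conv, integral_empMeasure]

/-- A minimum contrast estimator is as close to the truth, after convolution with the noise, as
the empirical distributions are. -/
theorem integral_cdf_conv_sub_sq_le_of_isMinContrast {ν q : Measure ℝ} [IsProbabilityMeasure ν]
    [IsProbabilityMeasure q] (hν : Integrable (fun x : ℝ => x) ν)
    (hq : Integrable (fun x : ℝ => x) q) {n : ℕ} (hn : n ≠ 0) {x y : ℕ → ℝ} {m m' : ℝ → ℝ}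
    (hm : IsMinContrast ν n x y m) (hm' : m' ∈ monoClass) :
    ∫ t, (cdf (empMeasure n (fun i => m (x i)) ∗ ν) t - cdf (q ∗ ν) t) ^ 2 ≤
      6 * (∫ t, (empCDF n y t - cdf (q ∗ ν) t) ^ 2) + 4 * ∫ t, ((n : ℝ)⁻¹ *
        ∑ i ∈ Finset.range n, cdf ν (t - m' (x i)) - cdf (q ∗ ν) t) ^ 2 := by
  have i1 := isProbabilityMeasure_empMeasure hn (fun i => m (x i))
  have i2 := isProbabilityMeasure_empMeasure hn (fun i => m' (x i))
  have i3 := isProbabilityMeasure_empMeasure hn y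
  have e1 : ∀ t, (n : ℝ)⁻¹ * ∑ i ∈ Finset.range n, cdf ν (t - m' (x i)) =
      cdf (empMeasure n (fun i => m' (x i)) ∗ ν) t := by
    intro t
    rw [cdf_conv, integral_empMeasure]
  simp_rw [e1, ← cdf_empMeasure hn]
  have hmin := hm.2 hm'
  rw [mem_ofPred_eq, contrast_eq_integral_cdf_sub hn, contrast_eq_integral_cdf_sub hn] at hmin
  have hA := integrable_id_conv (integrable_empMeasure hn (fun i => m (x i)) fun x => x) hν
  have hB := integrable_id_conv (integrable_empMeasure hn (fun i => m' (x i)) fun x => x) hν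
  have hY := integrable_empMeasure hn y fun x => x
  have hQ := integrable_id_conv hq hν
  -- With `A` the smoothed fit, `B` the smoothed competitor, `Y` the data, `Q` the truth: `AQ ≤ 2 AY
  -- + 2 YQ`, `AY ≤ YB` by minimality, `YB ≤ 2 YQ + 2 QB`; hence `6` and `4`.
  have t1 := integral_cdf_sub_sq_triangle hA hY hQ
  have t2 := integral_cdf_sub_sq_triangle hY hQ hB
  have s1 : ∀ a b : Measure ℝ, ∫ t, (cdf a t - cdf b t) ^ 2 = ∫ t, (cdf b t - cdf a t) ^ 2 := by
    intro a b
    congr 1; ext t; ring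
  rw [s1 (empMeasure n (fun i => m (x i)) ∗ ν) (empMeasure n y)] at t1
  rw [s1 (q ∗ ν) (empMeasure n (fun i => m' (x i)) ∗ ν)] at t2
  linarith

theorem integral_empL_sub_popL_sq_le_of_isMinContrast {ν : Measure ℝ} [IsProbabilityMeasure ν]
    (hν : Integrable (fun x : ℝ => x) ν) (hμ : ∀ᵐ x ∂μ, x ∈ Icc (0 : ℝ) 1)
    {n : ℕ} (hn : n ≠ 0) {x y : ℕ → ℝ} {m m' : ℝ → ℝ}
    (hm : IsMinContrast ν n x y m) (hm' : m' ∈ monoClass) (hmono : Monotone m')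
    {c T : ℝ} (hc : 0 < c) (hT : 0 < T) (h : ∀ t, |t| ≤ T → c ≤ ‖charFun ν t‖) :
    Integrable (fun w => (empL n x m w - popL μ m' w) ^ 2) ∧
    ∫ w, (empL n x m w - popL μ m' w) ^ 2 ≤
      (c ^ 2)⁻¹ * (6 * (∫ t, (empCDF n y t - cdf (μ.map m' ∗ ν) t) ^ 2) + 4 * ∫ t, ((n : ℝ)⁻¹ *
        ∑ i ∈ Finset.range n, cdf ν (t - m' (x i)) - cdf (μ.map m' ∗ ν) t) ^ 2) +
        4 / (Real.pi * T) := by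
  have i1 := isProbabilityMeasure_empMeasure hn (fun i => m (x i))
  have i2 : IsProbabilityMeasure (μ.map m') :=
    Measure.isProbabilityMeasure_map hmono.measurable.aemeasurable
  have hA := integrable_empMeasure hn (fun i => m (x i)) fun x => x
  have hq := integrable_id_map_of_monoClass hμ hmono hm'
  simp_rw [empL_eq_empCDF, popL_eq_cdf hmono.measurable, ← cdf_empMeasure hn]
  refine ⟨(memLp_two_cdf_sub_cdf hA hq).integrable_sq, ?_⟩
  -- `S = T / (2π)` since the Fourier variable `ξ` corresponds to the argument `-2πξ` of `charFun`.
  have hdec := integral_cdf_sub_cdf_sq_le hA hq hν hc (S := T / (2 * Real.pi)) (by positivity)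
    fun ξ hξ => h _ (by
      rw [abs_neg, abs_mul, abs_of_pos Real.two_pi_pos]
      rwa [le_div_iff₀ Real.two_pi_pos, mul_comm] at hξ)
  have hmin := integral_cdf_conv_sub_sq_le_of_isMinContrast hν hq hn hm hm'
  simp_rw [← cdf_empMeasure hn] at hmin
  have e : 2 / (Real.pi ^ 2 * (T / (2 * Real.pi))) = 4 / (Real.pi * T) := by
    field_simp
    norm_num
  rw [e] at hdec
  have := mul_le_mul_of_nonneg_left hmin (show 0 ≤ (c ^ 2)⁻¹ by positivity)
  linarith

end MonotoneRegression

/-! ### Rates of convergence. -/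

section Rates

/-- The uniform error `K` pays for the length of the interval, whereas the `L²` error `g` is
integrated over the whole line. -/
theorem abs_intervalIntegral_le_of_le_const_add {a b K : ℝ} (hab : a ≤ b) {f g : ℝ → ℝ}
    (hf : ∀ w, 0 ≤ f w) (hg0 : ∀ w, 0 ≤ g w) (hg : Integrable g) (h : ∀ w, f w ≤ K + g w) :
    |∫ w in a..b, f w| ≤ (b - a) * K + ∫ w, g w := by
  rw [abs_of_nonneg (intervalIntegral.integral_nonneg hab fun w _ => hf w),
    intervalIntegral.integral_of_le hab]
  have hK : IntegrableOn (fun _ => K) (Ioc a b) := integrableOn_const (by simp)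
  refine (integral_mono_of_nonneg (Filter.Eventually.of_forall hf) (hK.add hg.integrableOn)
    (Filter.Eventually.of_forall h)).trans ?_
  simp only [Pi.add_apply]
  rw [integral_add hK hg.integrableOn]
  refine add_le_add (le_of_eq ?_) (setIntegral_le_integral hg (Filter.Eventually.of_forall hg0))
  simp [hab]

/-- For `T = n^(1/(2β+1))` the variance factor `T^(2β) / n` and the tail `1 / T` are both the target
rate. -/
theorem deconvolution_rate_eq {β : ℝ} (hβ : 0 < β) {n : ℕ} (hn : 1 ≤ n) :
    ((n : ℝ) ^ (1 / (2 * β + 1))) ^ β * ((n : ℝ) ^ (1 / (2 * β + 1))) ^ β =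
        (n : ℝ) ^ (2 * β / (2 * β + 1)) ∧
      (n : ℝ) ^ (2 * β / (2 * β + 1)) * (1 / n) = (n : ℝ) ^ (-1 / (2 * β + 1)) ∧
      ((n : ℝ) ^ (1 / (2 * β + 1)))⁻¹ = (n : ℝ) ^ (-1 / (2 * β + 1)) := by
  have hn' : (0 : ℝ) < n := by exact_mod_cast hn
  have hb : 2 * β + 1 ≠ 0 := by positivity
  refine ⟨?_, ?_, ?_⟩
  · rw [← Real.rpow_mul hn'.le, ← Real.rpow_add hn']
    congr 1; ring
  · rw [one_div, ← Real.rpow_neg_one, ← Real.rpow_add hn']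
    congr 1; field_simp; ring
  · rw [← Real.rpow_neg hn'.le]
    congr 1; ring

variable {Ω : Type*} [MeasurableSpace Ω] {P : Measure Ω}

theorem exists_bound_of_isBigOInProb {Z : ℕ → Ω → ℝ} {r : ℕ → ℝ} (h : IsBigOInProb P Z r) {ε : ℝ}
    (hε : 0 < ε) : ∃ C : ℝ, 0 < C ∧ ∃ N : ℕ, ∀ n, N ≤ n →
      P {ω | ¬ |Z n ω| ≤ C * r n} ≤ ENNReal.ofReal ε := by
  simpa only [not_le] using h ε hε

variable [IsProbabilityMeasure P] {μX ν : Measure ℝ} [IsProbabilityMeasure μX]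
  [IsProbabilityMeasure ν]

theorem map_prod_add_eq_conv {m m' : ℝ → ℝ} (hm' : Measurable m') (h : ∀ᵐ x ∂μX, m x = m' x) :
    (μX.prod ν).map (fun p => m p.1 + p.2) = μX.map m' ∗ ν := by
  have h1 : (μX.prod ν).map (fun p => m p.1 + p.2) = (μX.prod ν).map (fun p => m' p.1 + p.2) := by
    refine Measure.map_congr ?_
    filter_upwards [Measure.quasiMeasurePreserving_fst.ae h] with p hp
    rw [hp]
  have : IsProbabilityMeasure (μX.map m') := Measure.isProbabilityMeasure_map hm'.aemeasurable
  have h2 : (μX.map m').prod ν = (μX.prod ν).map (Prod.map m' id) := by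
    rw [← Measure.map_prod_map _ _ hm' measurable_id, Measure.map_id]
  rw [h1, Measure.conv, h2, Measure.map_map (by fun_prop) (hm'.prodMap measurable_id)]
  rfl

theorem isBigOInProb_integral_empCDF_sub_sq {Y : ℕ → Ω → ℝ} (hY : ∀ i, Measurable (Y i))
    (hind : iIndepFun Y P) {ρ : Measure ℝ} [IsProbabilityMeasure ρ]
    (hlaw : ∀ i, P.map (Y i) = ρ) (hρ : Integrable (fun x : ℝ => x) ρ) :
    IsBigOInProb P (fun n ω => ∫ t, (empCDF n (fun i => Y i ω) t - cdf ρ t) ^ 2)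
      (fun n => 1 / (n : ℝ)) := by
  have hst : ∀ t, Measurable fun a => stepAt a t := fun t =>
    measurable_uncurry_stepAt.comp (measurable_id.prodMk measurable_const)
  refine isBigOInProb_integral_sq_mean_sub (G := fun i ω t => stepAt (Y i ω) t) (fun i => ?_)
    (fun i ω t => ?_) (fun t i j hij => (hind.indepFun hij).comp (hst t) (hst t)) (fun i t => ?_)
    (monotone_cdf ρ).measurable
    (fun t => mul_nonneg (cdf_nonneg ρ t) (sub_nonneg.2 (cdf_le_one ρ t)))
    (integrable_cdf_mul_one_sub hρ)
  · exact measurable_uncurry_stepAt.comp (((hY i).comp measurable_fst).prodMk measurable_snd)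
  · simp only [stepAt, indicator]
    split_ifs <;> simp
  · rw [cdf_eq_integral_stepAt, ← hlaw i,
      integral_map (hY i).aemeasurable (hst t).aestronglyMeasurable]

theorem isBigOInProb_integral_mean_cdf_sub_sq {X : ℕ → Ω → ℝ} (hX : ∀ i, Measurable (X i))
    (hind : iIndepFun X P) (hlaw : ∀ i, P.map (X i) = μX) {m : ℝ → ℝ} (hm : Measurable m)
    (hq : Integrable (fun x : ℝ => x) (μX.map m)) (hν : Integrable (fun x : ℝ => x) ν) :
    IsBigOInProb P (fun n ω => ∫ t, ((n : ℝ)⁻¹ * ∑ i ∈ Finset.range n, cdf ν (t - m (X i ω)) -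
      cdf (μX.map m ∗ ν) t) ^ 2) (fun n => 1 / (n : ℝ)) := by
  have : IsProbabilityMeasure (μX.map m) := Measure.isProbabilityMeasure_map hm.aemeasurable
  have hcm : Measurable (cdf ν) := (monotone_cdf ν).measurable
  have hst : ∀ t, Measurable fun a => cdf ν (t - m a) := fun t => hcm.comp (hm.const_sub t)
  refine isBigOInProb_integral_sq_mean_sub (G := fun i ω t => cdf ν (t - m (X i ω))) (fun i => ?_)
    (fun i ω t => ⟨cdf_nonneg ν _, cdf_le_one ν _⟩)
    (fun t i j hij => (hind.indepFun hij).comp (hst t) (hst t)) (fun i t => ?_)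
    (monotone_cdf _).measurable
    (fun t => mul_nonneg (cdf_nonneg _ t) (sub_nonneg.2 (cdf_le_one _ t)))
    (integrable_cdf_mul_one_sub (integrable_id_conv hq hν))
  · exact hcm.comp (measurable_snd.sub (hm.comp ((hX i).comp measurable_fst)))
  · have hct : Measurable fun a => cdf ν (t - a) := hcm.comp (measurable_id.const_sub t)
    rw [cdf_conv, integral_map hm.aemeasurable hct.aestronglyMeasurable, ← hlaw i,
      integral_map (hX i).aemeasurable (hst t).aestronglyMeasurable]

end Rates

/-! ### The main theorem. -/

theorem proposition3
    {Ω : Type*} [MeasurableSpace Ω] (P : Measure Ω) [IsProbabilityMeasure P]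
    -- laws of the covariate and of the noise, and the regression function
    (μX ν : Measure ℝ) [IsProbabilityMeasure μX] [IsProbabilityMeasure ν]
    (m₀ : ℝ → ℝ) (hm₀ : MonotoneOn m₀ (Icc 0 1))
    -- two independent i.i.d. samples
    (X Y : ℕ → Ω → ℝ)
    (hXmeas : ∀ i, Measurable (X i)) (hYmeas : ∀ i, Measurable (Y i))
    (hXindep : iIndepFun X P) (hYindep : iIndepFun Y P)
    (hXY : IndepFun (fun ω i => X i ω) (fun ω i => Y i ω) P)
    (hXlaw : ∀ i, P.map (X i) = μX)
    (hX01 : ∀ i, ∀ᵐ ω ∂P, X i ω ∈ Icc (0 : ℝ) 1)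
    -- each response is distributed as `m₀(X) + ε` with `X` and `ε` independent
    (hYlaw : ∀ i, P.map (Y i) = (μX.prod ν).map (fun p => m₀ p.1 + p.2))
    -- the noise is centred
    (hνint : Integrable (fun e : ℝ => e) ν) (hνmean : ∫ e, e ∂ν = 0)
    -- `F₀` is continuous
    (hF₀ : Continuous (cdf μX))
    -- the noise has an even, ordinary smooth density of order `β`
    (f : ℝ → ℝ) (hf : IsDensityOf f ν) (hfeven : ∀ x, f (-x) = f x)
    (β : ℝ) (hβ : 0 < β) (hsmooth : OrdinarySmooth f β)
    -- minimum contrast estimators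
    (mhat : ℕ → Ω → ℝ → ℝ)
    (hmhat : ∀ n, 1 ≤ n → ∀ᵐ ω ∂P,
      IsMinContrast ν n (fun i => X i ω) (fun i => Y i ω) (mhat n ω)) :
    (∃ Z : ℕ → Ω → ℝ, (∀ n, Measurable (Z n)) ∧ IsBigOInProb P Z (fun n => 1 / (n : ℝ)) ∧
      ∀ n, 1 ≤ n → ∀ A B : Ω → ℝ, Measurable A → Measurable B → (∀ᵐ ω ∂P, A ω < B ω) →
        ∀ᵐ ω ∂P, ∫ w in (A ω)..(B ω),
            (empL n (fun i => X i ω) (mhat n ω) w - popL μX (mhat n ω) w) ^ 2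
          ≤ (B ω - A ω) * Z n ω) ∧
    (∃ Z : ℕ → Ω → ℝ, (∀ n, Measurable (Z n)) ∧ IsBigOInProb P Z (fun n => 1 / (n : ℝ)) ∧
      ∀ n, 1 ≤ n → ∀ A B : Ω → ℝ, Measurable A → Measurable B → (∀ᵐ ω ∂P, A ω < B ω) →
        ∀ᵐ ω ∂P, ∫ w in (A ω)..(B ω),
            (empL n (fun i => X i ω) m₀ w - popL μX m₀ w) ^ 2
          ≤ (B ω - A ω) * Z n ω) ∧
    (TailDominated f →
      ∀ A B : ℕ → Ω → ℝ, (∀ n, Measurable (A n)) → (∀ n, Measurable (B n)) →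
        (∀ n, ∀ᵐ ω ∂P, A n ω < B n ω) →
        IsBigOInProb P (fun n ω => B n ω - A n ω)
          (fun n => (n : ℝ) ^ (2 * β / (2 * β + 1))) →
        IsBigOInProb P
          (fun n ω => ∫ w in (A n ω)..(B n ω),
            (popL μX (mhat n ω) w - popL μX m₀ w) ^ 2)
          (fun n => (n : ℝ) ^ (-1 / (2 * β + 1)))) := by
  have hXae : ∀ᵐ ω ∂P, ∀ i, X i ω ∈ Icc (0 : ℝ) 1 := ae_all_iff.2 hX01
  have hμ01 : ∀ᵐ x ∂μX, x ∈ Icc (0 : ℝ) 1 := by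
    rw [← hXlaw 0]
    exact (ae_map_iff (hXmeas 0).aemeasurable measurableSet_Icc).2 (hX01 0)
  have hks := isBigOInProb_ksDist_sq hF₀ hXmeas hXindep hXlaw
  have hXv : Measurable fun ω => (fun i => X i ω) := measurable_pi_lambda _ hXmeas
  have hksm : ∀ n, Measurable fun ω => ksDist μX n (fun i => X i ω) ^ 2 := fun n =>
    ((measurable_ksDist μX n).comp hXv).pow_const 2
  refine ⟨⟨fun n ω => ksDist μX n (fun i => X i ω) ^ 2, hksm, hks, ?_⟩,
    ⟨fun n ω => ksDist μX n (fun i => X i ω) ^ 2, hksm, hks, ?_⟩, ?_⟩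
  · intro n hn A B _ _ hAB
    filter_upwards [hXae, hAB, hmhat n hn] with ω hω hlt hm
    exact intervalIntegral_empL_sub_popL_sq_le hF₀ hμ01 (by omega) hω hm.1.1 hlt.le
  · intro n hn A B _ _ hAB
    filter_upwards [hXae, hAB] with ω hω hlt
    exact intervalIntegral_empL_sub_popL_sq_le hF₀ hμ01 (by omega) hω hm₀ hlt.le
  intro htail A B _ _ hAB hBA
  obtain ⟨m₁, hmono, hm₁, hae⟩ := exists_monotone_rightCts_ae_eq hF₀ hμ01 hm₀
  have hq := integrable_id_map_of_monoClass hμ01 hmono hm₁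
  have hqprob : IsProbabilityMeasure (μX.map m₁) :=
    Measure.isProbabilityMeasure_map hmono.measurable.aemeasurable
  have hVY := isBigOInProb_integral_empCDF_sub_sq hYmeas hYindep
    (fun i => (hYlaw i).trans (map_prod_add_eq_conv hmono.measurable hae))
    (integrable_id_conv hq hνint)
  have hVX := isBigOInProb_integral_mean_cdf_sub_sq hXmeas hXindep hXlaw hmono.measurable hq hνint
  obtain ⟨d₀, d₁, R, hd₀, -, hR, hbd⟩ := hsmooth
  obtain ⟨Tstar, hTstar⟩ := htail
  have hrate : Filter.Tendsto (fun n : ℕ => (n : ℝ) ^ (1 / (2 * β + 1))) Filter.atTop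
      Filter.atTop :=
    (tendsto_rpow_atTop (by positivity)).comp tendsto_natCast_atTop_atTop
  obtain ⟨N₀, hN₀⟩ := Filter.eventually_atTop.1
    ((hrate.eventually_gt_atTop Tstar).and (hrate.eventually_ge_atTop R))
  intro ε hε
  obtain ⟨C₁, hC₁, N₁, h₁⟩ := exists_bound_of_isBigOInProb hBA (show 0 < ε / 4 by positivity)
  obtain ⟨C₂, hC₂, N₂, h₂⟩ := exists_bound_of_isBigOInProb hks (show 0 < ε / 4 by positivity)
  obtain ⟨C₃, hC₃, N₃, h₃⟩ := exists_bound_of_isBigOInProb hVY (show 0 < ε / 4 by positivity)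
  obtain ⟨C₄, hC₄, N₄, h₄⟩ := exists_bound_of_isBigOInProb hVX (show 0 < ε / 4 by positivity)
  -- The three terms are twice the Kolmogorov–Smirnov error over length `B - A`, the in-band error,
  -- and the tail `4 / (πT)`. Each of the four stochastic bounds fails with probability at most `ε /
  -- 4`.
  refine ⟨2 * (C₁ * C₂) + 2 * ((6 * C₃ + 4 * C₄) / d₀ ^ 2) + 8 / Real.pi, by positivity,
    max (max N₀ 1) (max (max N₁ N₂) (max N₃ N₄)), fun n hn => ?_⟩
  simp only [max_le_iff] at hn
  obtain ⟨⟨hn0, hn1⟩, ⟨hnN₁, hnN₂⟩, hnN₃, hnN₄⟩ := hn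
  have hn' : (0 : ℝ) < n := by exact_mod_cast hn1
  obtain ⟨hT1, hT2⟩ := hN₀ n hn0
  obtain ⟨hr1, hr2, hr3⟩ := deconvolution_rate_eq hβ hn1
  set T := (n : ℝ) ^ (1 / (2 * β + 1))
  set s := (n : ℝ) ^ (2 * β / (2 * β + 1))
  set r := (n : ℝ) ^ (-1 / (2 * β + 1))
  have hT : 0 < T := Real.rpow_pos_of_pos hn' _
  have hs : 0 < s := Real.rpow_pos_of_pos hn' _
  have hTβ : 0 < T ^ β := Real.rpow_pos_of_pos hT _
  -- Ordinary smoothness bounds the characteristic function below only at the endpoint `T`; tail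
  -- domination spreads this over `|t| ≤ T`.
  have hband : ∀ t, |t| ≤ T → d₀ / T ^ β ≤ ‖charFun ν t‖ := by
    intro t ht
    have h := (hbd T (by rwa [abs_of_pos hT])).1
    rw [abs_of_pos hT] at h
    rw [charFun_eq_phi hf]
    exact h.trans (hTstar T hT1 t ht).1
  have hc2 : ((d₀ / T ^ β) ^ 2)⁻¹ = s / d₀ ^ 2 := by
    rw [div_pow, inv_div, ← hr1, sq (T ^ β)]
  set E₁ := {ω | ¬ |B n ω - A n ω| ≤ C₁ * s}
  set E₂ := {ω | ¬ |ksDist μX n (fun i => X i ω) ^ 2| ≤ C₂ * (1 / (n : ℝ))}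
  set E₃ := {ω | ¬ |∫ t, (empCDF n (fun i => Y i ω) t - cdf (μX.map m₁ ∗ ν) t) ^ 2| ≤
    C₃ * (1 / (n : ℝ))}
  set E₄ := {ω | ¬ |∫ t, ((n : ℝ)⁻¹ * ∑ i ∈ Finset.range n, cdf ν (t - m₁ (X i ω)) -
    cdf (μX.map m₁ ∗ ν) t) ^ 2| ≤ C₄ * (1 / (n : ℝ))}
  have hsub : {ω | (2 * (C₁ * C₂) + 2 * ((6 * C₃ + 4 * C₄) / d₀ ^ 2) + 8 / Real.pi) * r <
      |∫ w in (A n ω)..(B n ω), (popL μX (mhat n ω) w - popL μX m₀ w) ^ 2|} ≤ᵐ[P]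
      (E₁ ∪ E₂ ∪ (E₃ ∪ E₄) : Set Ω) := by
    filter_upwards [hXae, hAB n, hmhat n hn1] with ω hω hlt hm hmem
    by_contra hcon
    have hcon' : ω ∉ E₁ ∪ E₂ ∪ (E₃ ∪ E₄) := hcon
    simp only [mem_union, not_or, E₁, E₂, E₃, E₄, mem_ofPred_eq, not_not] at hcon'
    obtain ⟨⟨b1, b2⟩, b3, b4⟩ := hcon'
    refine absurd (show _ < _ from hmem) (not_lt.2 ?_)
    obtain ⟨hint, hle⟩ := integral_empL_sub_popL_sq_le_of_isMinContrast hνint hμ01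
      (by omega : n ≠ 0) hm hm₁ hmono (div_pos hd₀ hTβ) hT hband
    rw [hc2] at hle
    -- Insert `empL` at `mhat` and use `(a + b)² ≤ 2a² + 2b²`.
    have hpt : ∀ w, (popL μX (mhat n ω) w - popL μX m₀ w) ^ 2 ≤
        2 * ksDist μX n (fun i => X i ω) ^ 2 +
        2 * (empL n (fun i => X i ω) (mhat n ω) w - popL μX m₁ w) ^ 2 := by
      intro w
      rw [popL_congr_ae hae]
      have h := pow_le_pow_left₀ (abs_nonneg _)
        (abs_empL_sub_popL_le_ksDist hF₀ hμ01 (by omega : n ≠ 0) hω hm.1.1 w) 2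
      rw [sq_abs] at h
      nlinarith [sq_nonneg ((popL μX (mhat n ω) w - empL n (fun i => X i ω) (mhat n ω) w) -
        (empL n (fun i => X i ω) (mhat n ω) w - popL μX m₁ w))]
    refine (abs_intervalIntegral_le_of_le_const_add hlt.le (fun _ => sq_nonneg _)
      (fun _ => mul_nonneg two_pos.le (sq_nonneg _)) (hint.const_mul 2) hpt).trans ?_
    rw [integral_const_mul]
    have k1 : (B n ω - A n ω) * (2 * ksDist μX n (fun i => X i ω) ^ 2) ≤ 2 * (C₁ * C₂) * r := by
      have := mul_le_mul ((le_abs_self _).trans b1) ((le_abs_self _).trans b2) (sq_nonneg _)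
        (by positivity)
      calc (B n ω - A n ω) * (2 * ksDist μX n (fun i => X i ω) ^ 2)
          = 2 * ((B n ω - A n ω) * ksDist μX n (fun i => X i ω) ^ 2) := by ring
        _ ≤ 2 * (C₁ * s * (C₂ * (1 / (n : ℝ)))) := by linarith
        _ = 2 * (C₁ * C₂) * r := by rw [← hr2]; ring
    have k2 := (le_abs_self _).trans b3
    have k3 := (le_abs_self _).trans b4
    have k4 : s / d₀ ^ 2 * (6 * (∫ t, (empCDF n (fun i => Y i ω) t -
        cdf (μX.map m₁ ∗ ν) t) ^ 2) + 4 * ∫ t, ((n : ℝ)⁻¹ *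
        ∑ i ∈ Finset.range n, cdf ν (t - m₁ (X i ω)) - cdf (μX.map m₁ ∗ ν) t) ^ 2) ≤
        (6 * C₃ + 4 * C₄) / d₀ ^ 2 * r := by
      calc _ ≤ s / d₀ ^ 2 * (6 * (C₃ * (1 / (n : ℝ))) + 4 * (C₄ * (1 / (n : ℝ)))) := by
            refine mul_le_mul_of_nonneg_left ?_ (by positivity)
            linarith
        _ = (6 * C₃ + 4 * C₄) / d₀ ^ 2 * r := by rw [← hr2]; ring
    have k5 : 4 / (Real.pi * T) = 4 / Real.pi * r := by
      rw [← hr3, ← div_div, div_eq_mul_inv _ T]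
    rw [k5] at hle
    have k6 : 8 / Real.pi * r = 2 * (4 / Real.pi * r) := by ring
    rw [add_mul, add_mul, k6]
    linarith
  refine (measure_mono_ae hsub).trans ((measure_union_le _ _).trans
    ((add_le_add (measure_union_le _ _) (measure_union_le _ _)).trans
    ((add_le_add (add_le_add (h₁ n hnN₁) (h₂ n hnN₂)) (add_le_add (h₃ n hnN₃)
      (h₄ n hnN₄))).trans_eq ?_)))
  rw [← ENNReal.ofReal_add (by positivity) (by positivity),
    ← ENNReal.ofReal_add (by positivity) (by positivity)]
  congr 1
  ring
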